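/- Let $R$ be a commutative ring with identity. An $R$-module $C$ is called semidualizing if $C$ has a projective resolution all of whose terms are finitely generated, the natural homothety map $R\to \operatorname{Hom}_R(C,C)$ is an isomorphism, and $\operatorname{Ext}^i_R(C,C)=0$ for all $i\ge 1$. Let $\mathcal P_C$ be the class of modules isomorphic to $C\otimes_R P$ with $P$ projective, and $\mathcal I_C$ the class of modules isomorphic to $\operatorname{Hom}_R(C,I)$ with $I$ injective. A proper $\mathcal P_C$-projective resolution of an $R$-module $M$ is a complex $X=(\cdots\to X_1\to X_0\to 0)$ with all $X_n\in\mathcal P_C$, together with an augmentation $X_0\to M$, such that $X^+=(\cdots\to X_1\to X_0\to M\to 0)$ is a complex and $\operatorname{Hom}_R(C\otimes_R Q,X^+)$ is exact for every projective $R$-module $Q$. Dually, a proper $\mathcal I_C$-injective resolution of $M$ is a complex $Y=(0\to Y^0\to Y^1\to\cdots)$ with all $Y^n\in\mathcal I_C$, together with a map $M\to Y^0$, such that $Y^+=(0\to M\to Y^0\to Y^1\to\cdots)$ is a complex and $\operatorname{Hom}_R(Y^+,\operatorname{Hom}_R(C,J))$ is exact for every injective $R$-module $J$. (Neither $X^+$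 nor $Y^+$ is required to be exact.) Put $$\mathcal P_C\text{-}\operatorname{pd}_R(M)=\inf_X\,\sup\{n\mid X_n\ne 0\},\qquad \mathcal I_C\text{-}\operatorname{id}_R(M)=\inf_Y\,\sup\{n\mid Y^n\ne 0\},$$ where $X$ and $Y$ run over the proper $\mathcal P_C$-projective, respectively proper $\mathcal I_C$-injective, resolutions of $M$. All dimensions take values in $\{-\infty\}\cup\mathbb N\cup\{\infty\}$, with $\sup\emptyset=-\infty$; in particular the projective dimension $\operatorname{pd}_R$ and the injective dimension $\operatorname{id}_R$ of the zero module are $-\infty$. **Theorem.** Let $C$ be a semidualizing $R$-module and let $M$ be any $R$-module. Then (a) $\operatorname{pd}_R(M)=\mathcal P_C\text{-}\operatorname{pd}_R(C\otimes_R M)$; (b) $\mathcal I_C\text{-}\operatorname{id}_R(M)=\operatorname{id}_R(C\otimes_R M)$; (c) $\mathcal P_C\text{-}\operatorname{pd}_R(M)=\operatorname{pd}_R(\operatorname{Hom}_R(C,M))$; (d) $\operatorname{id}_R(M)=\mathcal I_C\text{-}\operatorname{id}_R(\operatorname{Hom}_R(C,M))$. -/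

import Mathlib

open CategoryTheory
open scoped TensorProduct

universe u

section

variable (R : Type u) [CommRing R]

/-- The `R`-module `C` is semidualizing: it has a projective resolution by finitely generated
(projective) modules, the homothety map `R → Hom_R(C, C)` is an isomorphism, and
`Ext^i_R(C, C) = 0` for all `i ≥ 1`. -/
structure IsSemidualizing (C : Type u) [AddCommGroup C] [Module R C] : Prop where
  exists_finite_resolution :
    ∃ P : ProjectiveResolution (ModuleCat.of R C), ∀ n, Module.Finite R (P.complex.X n)
  homothety_bijective : Function.Bijective (LinearMap.lsmul R C)
  ext_self_eq_zero : ∀ i : ℕ, 1 ≤ i →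
    Subsingleton (Abelian.Ext (ModuleCat.of R C) (ModuleCat.of R C) i)

/-- The class `P_C` of modules isomorphic to `C ⊗ P` with `P` projective. -/
def IsCProjective (C : Type u) [AddCommGroup C] [Module R C]
    (X : Type u) [AddCommGroup X] [Module R X] : Prop :=
  ∃ (P : Type u) (_ : AddCommGroup P) (_ : Module R P),
    Module.Projective R P ∧ Nonempty (X ≃ₗ[R] C ⊗[R] P)

/-- The class `I_C` of modules isomorphic to `Hom(C, I)` with `I` injective. -/
def IsCInjective (C : Type u) [AddCommGroup C] [Module R C]
    (Y : Type u) [AddCommGroup Y] [Module R Y] : Prop :=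
  ∃ (I : Type u) (_ : AddCommGroup I) (_ : Module R I),
    Module.Injective R I ∧ Nonempty (Y ≃ₗ[R] (C →ₗ[R] I))

/-- A proper `P_C`-projective resolution of `M`, with its augmentation: a complex
`X⁺ = ⋯ → X 1 → X 0 → M → 0` with every `X n` in `P_C`, such that `Hom(C ⊗ Q, X⁺)` is exact for
every projective module `Q`. The complex `X⁺` itself need not be exact. -/
structure ProperPCResolution (C M : Type u) [AddCommGroup C] [Module R C]
    [AddCommGroup M] [Module R M] where
  X : ℕ → Type u
  [addCommGroup : ∀ n, AddCommGroup (X n)]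
  [module : ∀ n, Module R (X n)]
  d : ∀ n, X (n + 1) →ₗ[R] X n
  ε : X 0 →ₗ[R] M
  d_comp_d : ∀ n, d n ∘ₗ d (n + 1) = 0
  ε_comp_d : ε ∘ₗ d 0 = 0
  isCProjective : ∀ n, IsCProjective R C (X n)
  proper_augmentation : ∀ (Q : Type u) [AddCommGroup Q] [Module R Q] [Module.Projective R Q],
    Function.Surjective (fun f : C ⊗[R] Q →ₗ[R] X 0 => ε ∘ₗ f)
  proper_zero : ∀ (Q : Type u) [AddCommGroup Q] [Module R Q] [Module.Projective R Q],
    Function.Exact (fun f : C ⊗[R] Q →ₗ[R] X 1 => d 0 ∘ₗ f)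
      (fun f : C ⊗[R] Q →ₗ[R] X 0 => ε ∘ₗ f)
  proper_succ : ∀ (Q : Type u) [AddCommGroup Q] [Module R Q] [Module.Projective R Q] (n : ℕ),
    Function.Exact (fun f : C ⊗[R] Q →ₗ[R] X (n + 2) => d (n + 1) ∘ₗ f)
      (fun f : C ⊗[R] Q →ₗ[R] X (n + 1) => d n ∘ₗ f)

/-- A proper `I_C`-injective resolution of `M`, with its augmentation: a complex
`Y⁺ = 0 → M → Y 0 → Y 1 → ⋯` with every `Y n` in `I_C`, such that `Hom(Y⁺, Hom(C, J))` is exact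
for every injective module `J`. The complex `Y⁺` itself need not be exact. -/
structure ProperICResolution (C M : Type u) [AddCommGroup C] [Module R C]
    [AddCommGroup M] [Module R M] where
  Y : ℕ → Type u
  [addCommGroup : ∀ n, AddCommGroup (Y n)]
  [module : ∀ n, Module R (Y n)]
  d : ∀ n, Y n →ₗ[R] Y (n + 1)
  η : M →ₗ[R] Y 0
  d_comp_d : ∀ n, d (n + 1) ∘ₗ d n = 0
  d_comp_η : d 0 ∘ₗ η = 0
  isCInjective : ∀ n, IsCInjective R C (Y n)
  proper_augmentation : ∀ (J : Type u) [AddCommGroup J] [Module R J] [Module.Injective R J],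
    Function.Surjective (fun f : Y 0 →ₗ[R] (C →ₗ[R] J) => f ∘ₗ η)
  proper_zero : ∀ (J : Type u) [AddCommGroup J] [Module R J] [Module.Injective R J],
    Function.Exact (fun f : Y 1 →ₗ[R] (C →ₗ[R] J) => f ∘ₗ d 0)
      (fun f : Y 0 →ₗ[R] (C →ₗ[R] J) => f ∘ₗ η)
  proper_succ : ∀ (J : Type u) [AddCommGroup J] [Module R J] [Module.Injective R J] (n : ℕ),
    Function.Exact (fun f : Y (n + 2) →ₗ[R] (C →ₗ[R] J) => f ∘ₗ d (n + 1))
      (fun f : Y (n + 1) →ₗ[R] (C →ₗ[R] J) => f ∘ₗ d n)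

/-- The `P_C`-projective dimension of `M`: the infimum of `sup {n | X n ≠ 0}` over the proper
`P_C`-projective resolutions `X` of `M`. Values lie in `{-∞} ∪ ℕ ∪ {∞}`, and `sup ∅ = -∞ = ⊥`. -/
noncomputable def pcProjectiveDimension (C M : Type u) [AddCommGroup C] [Module R C]
    [AddCommGroup M] [Module R M] : WithBot ℕ∞ :=
  ⨅ X : ProperPCResolution R C M,
    sSup {k : WithBot ℕ∞ | ∃ n : ℕ, k = (n : WithBot ℕ∞) ∧ Nontrivial (X.X n)}

/-- The `I_C`-injective dimension of `M`: the infimum of `sup {n | Y n ≠ 0}` over the proper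
`I_C`-injective resolutions `Y` of `M`. Values lie in `{-∞} ∪ ℕ ∪ {∞}`, and `sup ∅ = -∞ = ⊥`. -/
noncomputable def icInjectiveDimension (C M : Type u) [AddCommGroup C] [Module R C]
    [AddCommGroup M] [Module R M] : WithBot ℕ∞ :=
  ⨅ Y : ProperICResolution R C M,
    sSup {k : WithBot ℕ∞ | ∃ n : ℕ, k = (n : WithBot ℕ∞) ∧ Nontrivial (Y.Y n)}

end

/-! Since `C` is semidualizing, the unit `P → Hom(C, C ⊗ P)` is an isomorphism for projective `P`,
and the counit `C ⊗ Hom(C, I) → I` is one for injective `I`. Hence `Hom(C, -)` turns a proper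
`P_C`-resolution of `M` into a projective resolution of `Hom(C, M)`, and `C ⊗ -` goes back, with the
same vanishing bounds. This is (c); (b) is dual, with injective resolutions of `C ⊗ M`.

Given (b) and (c), parts (a) and (d) say that `M` and `Hom(C, C ⊗ M)` have the same projective
dimension, and `M` and `C ⊗ Hom(C, M)` the same injective dimension. If `M` has finite projective
(injective) dimension, induction on the dimension places it in a weak form of the Auslander (Bass)
class of `C`, so its unit (counit) is bijective: `auslander_of_hasProjectiveDimensionLT`,
`bass_of_hasInjectiveDimensionLT`. If instead the composite module has finite dimension, it lies in
that class, and the triangle identities together with conservativity of `Hom(C, -)` and `C ⊗ -`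
carry bijectivity over to `M`.

Conservativity is `exists_linearMap_ne_zero_of_faithful`, a determinant argument that needs only `C`
finitely generated and faithful. -/

/-! ### Factoring linear maps through exact sequences. -/

section Exactness

variable {R : Type*} [CommRing R] {A B D N : Type*} [AddCommGroup A] [AddCommGroup B]
  [AddCommGroup D] [AddCommGroup N] [Module R A] [Module R B] [Module R D] [Module R N]

lemma Function.Exact.exists_desc {u : A →ₗ[R] B} {v : B →ₗ[R] D} (h : Function.Exact u v)
    (hv : Function.Surjective v) (φ : B →ₗ[R] N) (hφ : φ ∘ₗ u = 0) :
    ∃ ψ : D →ₗ[R] N, ψ ∘ₗ v = φ := by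
  have hle : LinearMap.ker v ≤ LinearMap.ker φ := by
    intro b hb
    obtain ⟨a, rfl⟩ := (h b).1 hb
    exact LinearMap.congr_fun hφ a
  refine ⟨(LinearMap.ker v).liftQ φ hle ∘ₗ (v.quotKerEquivOfSurjective hv).symm.toLinearMap, ?_⟩
  ext b
  have : (v.quotKerEquivOfSurjective hv).symm (v b) = Submodule.Quotient.mk b := by
    rw [LinearEquiv.symm_apply_eq]; rfl
  simp [this]

lemma Function.Exact.exists_lift {u : A →ₗ[R] B} {v : B →ₗ[R] D} (h : Function.Exact u v)
    (hu : Function.Injective u) (φ : N →ₗ[R] B) (hφ : v ∘ₗ φ = 0) :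
    ∃ ψ : N →ₗ[R] A, u ∘ₗ ψ = φ := by
  have hmem : ∀ x, φ x ∈ LinearMap.range u := fun x => (h _).1 (LinearMap.congr_fun hφ x)
  refine ⟨(LinearEquiv.ofInjective u hu).symm.toLinearMap ∘ₗ φ.codRestrict _ hmem, ?_⟩
  ext x
  exact congrArg Subtype.val
    ((LinearEquiv.ofInjective u hu).apply_symm_apply (φ.codRestrict _ hmem x))

lemma Function.Exact.exists_lift_of_projective [Module.Projective R N]
    {u : A →ₗ[R] B} {v : B →ₗ[R] D} (h : Function.Exact u v)
    (φ : N →ₗ[R] B) (hφ : v ∘ₗ φ = 0) : ∃ ψ : N →ₗ[R] A, u ∘ₗ ψ = φ := by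
  have hmem : ∀ x, φ x ∈ LinearMap.range u := fun x => (h _).1 (LinearMap.congr_fun hφ x)
  obtain ⟨ψ, hψ⟩ := Module.projective_lifting_property u.rangeRestrict
    (φ.codRestrict _ hmem) u.surjective_rangeRestrict
  exact ⟨ψ, LinearMap.ext fun x => congrArg Subtype.val (LinearMap.congr_fun hψ x)⟩

end Exactness

lemma Function.Exact.exists_desc_of_injective {R : Type u} [CommRing R] {A B D : Type*}
    {J : Type u} [AddCommGroup A] [AddCommGroup B] [AddCommGroup D] [AddCommGroup J]
    [Module R A] [Module R B] [Module R D] [Module R J] [Module.Injective R J]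
    {u : A →ₗ[R] B} {v : B →ₗ[R] D} (h : Function.Exact u v)
    (φ : B →ₗ[R] J) (hφ : φ ∘ₗ u = 0) : ∃ ψ : D →ₗ[R] J, ψ ∘ₗ v = φ := by
  have h' : Function.Exact u v.rangeRestrict := by
    intro b
    rw [← h b, Subtype.ext_iff]
    rfl
  obtain ⟨χ, hχ⟩ := h'.exists_desc v.surjective_rangeRestrict φ hφ
  obtain ⟨ψ, hψ⟩ := Module.Injective.extension_property R J _ _ (LinearMap.range v).subtype
    (Submodule.injective_subtype _) χ
  refine ⟨ψ, ?_⟩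
  rw [← hχ, ← hψ]
  rfl

/-! ### Nonzero maps out of a finitely generated faithful module. -/

section Faithful

open Matrix

variable {R : Type*} [CommRing R] {C : Type*} [AddCommGroup C] [Module R C]

/-- Cramer's rule: multiply the relations by the adjugate. -/
lemma Matrix.det_smul_eq_zero_of_sum_eq_zero {m : ℕ} (A : Matrix (Fin m) (Fin m) R)
    (w : Fin m → C) (h : ∀ i, ∑ j, A i j • w j = 0) (k : Fin m) : A.det • w k = 0 := by
  have h1 : ∑ i, A.adjugate k i • ∑ j, A i j • w j = A.det • w k := by
    simp_rw [Finset.smul_sum, smul_smul]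
    rw [Finset.sum_comm]
    simp_rw [← Finset.sum_smul]
    have : ∀ j, ∑ i, A.adjugate k i * A i j = (A.det • (1 : Matrix (Fin m) (Fin m) R)) k j := by
      intro j
      rw [← Matrix.adjugate_mul, Matrix.mul_apply]
    simp_rw [this]
    rw [Finset.sum_eq_single k]
    · simp
    · intro b _ hb
      simp [Matrix.one_apply_ne hb.symm]
    · simp
  rw [← h1]
  simp [h]

/-- A finitely generated faithful module maps nontrivially to every nonzero module. -/
theorem exists_linearMap_ne_zero_of_faithful [Module.Finite R C]
    (hfaith : ∀ r : R, (∀ c : C, r • c = 0) → r = 0)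
    {N : Type*} [AddCommGroup N] [Module R N] {x : N} (hx : x ≠ 0) :
    ∃ f : C →ₗ[R] N, f ≠ 0 := by
  obtain ⟨n, π, hπ⟩ := Module.Finite.exists_fin' R C
  -- `P m`: some `m × m` minor of the relation matrix of `C` (rows `S`, columns `T`) does not kill
  -- `x`. The argument takes such a minor with no larger one of size `m + 1`.
  let P : ℕ → Prop := fun m => ∃ (S : Fin m → Fin n → R) (T : Fin m → Fin n),
    (∀ i, π (S i) = 0) ∧ (Matrix.of fun i j => S i (T j)).det • x ≠ 0
  have hinj : ∀ (m : ℕ) (S : Fin m → Fin n → R) (T : Fin m → Fin n),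
      (Matrix.of fun i j => S i (T j)).det • x ≠ 0 → Function.Injective T := by
    intro m S T h i j hij
    by_contra hne
    refine h ?_
    rw [Matrix.det_zero_of_column_eq hne (by intro k; simp [hij]), zero_smul]
  obtain ⟨m, ⟨S, T, hS, hST⟩, hm⟩ : ∃ m, P m ∧ ¬ P (m + 1) := by
    by_contra! hcon
    have hall : ∀ m, P m := by
      intro m
      induction m with
      | zero => exact ⟨Fin.elim0, Fin.elim0, fun i => i.elim0, by simpa using hx⟩
      | succ m ih => exact hcon m ih
    obtain ⟨S, T, -, h⟩ := hall (n + 1)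
    have := Fintype.card_le_of_injective T (hinj _ S T h)
    simp at this
  have hT := hinj _ S T hST
  -- If the minor used every column, it would annihilate every generator of `C` by Cramer's rule,
  -- hence vanish by faithfulness.
  obtain ⟨t, ht⟩ : ∃ t, ∀ j, T j ≠ t := by
    by_contra! hsurj
    let e : Fin m ≃ Fin n := Equiv.ofBijective T ⟨hT, hsurj⟩
    have hdet : (Matrix.of fun i j => S i (T j)).det = 0 := by
      refine hfaith _ ?_
      have hkey := Matrix.det_smul_eq_zero_of_sum_eq_zero (Matrix.of fun i j => S i (T j))
        (fun j => π (Pi.single (T j) 1)) (by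
          intro i
          have h1 : S i = ∑ k, S i k • (Pi.single k 1 : Fin n → R) := pi_eq_sum_univ' (S i)
          have h2 := hS i
          rw [h1, map_sum, ← e.sum_comp] at h2
          simp only [map_smul] at h2
          exact h2)
      intro c
      obtain ⟨r, rfl⟩ := hπ c
      rw [pi_eq_sum_univ' r, map_sum, Finset.smul_sum]
      refine Finset.sum_eq_zero fun k _ => ?_
      obtain ⟨j, rfl⟩ := hsurj k
      rw [map_smul, smul_comm, hkey j, smul_zero]
    exact hST (by rw [hdet, zero_smul])
  let T' : Fin (m + 1) → Fin n := Fin.cons t T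
  let B : Fin (m + 1) → Fin (m + 1) → R :=
    fun i j => (Fin.cons 0 S : Fin (m + 1) → Fin n → R) i (T' j)
  -- Border the minor by column `t` and a variable first row `r`. Since `m` cannot be increased, the
  -- resulting functional kills all relations and so descends to `C`; at the basis vector of `t` it
  -- returns the old minor times `x`.
  let φ : (Fin n → R) →ₗ[R] N := LinearMap.toSpanSingleton R N x ∘ₗ
    (Matrix.detRowAlternating.toMultilinearMap.toLinearMap B 0) ∘ₗ LinearMap.funLeft R R T'
  have hφ : ∀ r, φ r = (Matrix.of fun i j =>
      (Fin.cons r S : Fin (m + 1) → Fin n → R) i (T' j)).det • x := by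
    intro r
    change Matrix.det (Function.update B 0 (r ∘ T')) • x = _
    congr 2
    ext i j
    refine Fin.cases ?_ (fun i => ?_) i
    · simp
    · simp [B]
  have hker : φ ∘ₗ (LinearMap.ker π).subtype = 0 := by
    ext ⟨r, hr⟩
    by_contra hne
    refine hm ⟨Fin.cons r S, T', ?_, ?_⟩
    · intro i
      refine Fin.cases ?_ (fun i => ?_) i
      · simpa using hr
      · simpa using hS i
    · rw [← hφ]
      exact hne
  have hex : Function.Exact (LinearMap.ker π).subtype π := fun b => by simp
  obtain ⟨ψ, hψ⟩ := hex.exists_desc hπ φ hker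
  refine ⟨ψ, ?_⟩
  rintro rfl
  refine hST ?_
  have h0 : φ (Pi.single t 1) = 0 := by rw [← hψ]; simp
  rw [hφ, Matrix.det_succ_row_zero, Fin.sum_univ_succ, Finset.sum_eq_zero] at h0
  · simpa [T', Matrix.submatrix, Fin.succAbove_zero] using h0
  · intro j _
    simp [T', ht j]

end Faithful

/-! ### Projective resolutions by linear maps, and vanishing of Ext. -/

section Resolution

variable (R : Type u) [CommRing R]

/-- A projective resolution of `M`, as a sequence of linear maps. -/
structure LinearProjectiveResolution (M : Type u) [AddCommGroup M] [Module R M] where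
  X : ℕ → ModuleCat.{u} R
  d : ∀ n, X (n + 1) →ₗ[R] X n
  ε : X 0 →ₗ[R] M
  projective : ∀ n, Module.Projective R (X n)
  surjective : Function.Surjective ε
  exact_zero : Function.Exact (d 0) ε
  exact_succ : ∀ n, Function.Exact (d (n + 1)) (d n)

attribute [instance] LinearProjectiveResolution.projective

/-- `Ext^i(M, N) = 0` for `i ≥ 1`, computed by a projective resolution of `M`. -/
def LinearProjectiveResolution.ExtVanish {R : Type u} [CommRing R] {M : Type u} [AddCommGroup M]
    [Module R M] (F : LinearProjectiveResolution R M)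
    (N : Type u) [AddCommGroup N] [Module R N] : Prop :=
  ∀ (n : ℕ) (f : F.X (n + 1) →ₗ[R] N), f ∘ₗ F.d (n + 1) = 0 →
    ∃ g : F.X n →ₗ[R] N, g ∘ₗ F.d n = f

variable {R}

/-- Translates the categorical resolution and `Abelian.Ext` into cocycles and coboundaries, so that
everything later is a diagram chase with linear maps. -/
lemma IsSemidualizing.exists_resolution {C : Type u} [AddCommGroup C] [Module R C]
    (hC : IsSemidualizing R C) :
    ∃ F : LinearProjectiveResolution R C, (∀ n, Module.Finite R (F.X n)) ∧ F.ExtVanish C := by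
  obtain ⟨P, hP⟩ := hC.exists_finite_resolution
  have hS : ShortComplex.Exact (ShortComplex.mk _ _ P.complex_d_comp_π_f_zero) :=
    ShortComplex.exact_of_g_is_cokernel _ P.isColimitCokernelCofork
  refine ⟨⟨fun n => P.complex.X n, fun n => (P.complex.d (n + 1) n).hom, (P.π.f 0).hom,
    fun n => (IsProjective.iff_projective _).2 (P.projective n),
    (ModuleCat.epi_iff_surjective (P.π.f 0)).1 inferInstance,
    (ShortComplex.ShortExact.moduleCat_exact_iff_function_exact _).1 hS,
    fun n => (ShortComplex.ShortExact.moduleCat_exact_iff_function_exact _).1 (P.exact_succ n)⟩,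
    hP, ?_⟩
  intro n f hf
  have hs := hC.ext_self_eq_zero (n + 1) (by omega)
  have hf' : P.complex.d (n + 2) (n + 1) ≫ (ModuleCat.ofHom f : _ ⟶ ModuleCat.of R C) = 0 :=
    ModuleCat.hom_ext hf
  obtain ⟨g, hg⟩ := (P.extMk_eq_zero_iff (ModuleCat.ofHom f) (n + 2) rfl hf' n rfl).1
    (Subsingleton.elim _ _)
  exact ⟨g.hom, congrArg ModuleCat.Hom.hom hg⟩

end Resolution

/-! ### Unit, counit, and conservativity of `Hom(C, -)` and `C ⊗ -`. -/

section Definitions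

variable {R : Type u} [CommRing R] (C M : Type u) [AddCommGroup C] [Module R C]
  [AddCommGroup M] [Module R M]

/-- The unit `M → Hom(C, C ⊗ M)`. -/
noncomputable def tensorUnit : M →ₗ[R] C →ₗ[R] C ⊗[R] M := (TensorProduct.mk R C M).flip

/-- The counit `C ⊗ Hom(C, M) → M`. -/
noncomputable def homCounit : C ⊗[R] (C →ₗ[R] M) →ₗ[R] M := TensorProduct.lift LinearMap.applyₗ

variable {C M}

@[simp] lemma tensorUnit_apply (x : M) (c : C) : tensorUnit C M x c = c ⊗ₜ[R] x := rfl

@[simp] lemma homCounit_tmul (c : C) (f : C →ₗ[R] M) : homCounit C M (c ⊗ₜ[R] f) = f c := rfl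

variable {N : Type u} [AddCommGroup N] [Module R N]

lemma lTensor_comp_tensorUnit (f : M →ₗ[R] N) (x : M) :
    f.lTensor C ∘ₗ tensorUnit C M x = tensorUnit C N (f x) := by
  ext c; simp

lemma homCounit_lTensor (f : M →ₗ[R] N) (z : C ⊗[R] (C →ₗ[R] M)) :
    homCounit C N ((LinearMap.compRight R f).lTensor C z) = f (homCounit C M z) := by
  induction z with
  | zero => simp
  | add x y hx hy => simp only [map_add, hx, hy]
  | tmul c g => simp

lemma homCounit_comp_tensorUnit (f : C →ₗ[R] M) :
    homCounit C M ∘ₗ tensorUnit C (C →ₗ[R] M) f = f := by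
  ext c; simp

lemma homCounit_lTensor_tensorUnit (z : C ⊗[R] M) :
    homCounit C (C ⊗[R] M) ((tensorUnit C M).lTensor C z) = z := by
  induction z with
  | zero => simp
  | add x y hx hy => simp only [map_add, hx, hy]
  | tmul c g => simp

lemma IsSemidualizing.eq_zero_of_smul (hC : IsSemidualizing R C) (r : R)
    (h : ∀ c : C, r • c = 0) : r = 0 :=
  hC.homothety_bijective.1 (by ext c; simpa using h c)

lemma exists_injective_embedding (R : Type u) [CommRing R] (N : Type u) [AddCommGroup N]
    [Module R N] : ∃ (J : Type u) (_ : AddCommGroup J) (_ : Module R J) (_ : Module.Injective R J)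
      (i : N →ₗ[R] J), Function.Injective i :=
  ⟨(Injective.under (ModuleCat.of R N) : ModuleCat R), inferInstance, inferInstance,
    (Module.injective_iff_injective_object R _).2
      (inferInstanceAs (Injective (Injective.under (ModuleCat.of R N)))),
    (Injective.ι (ModuleCat.of R N)).hom, (ModuleCat.mono_iff_injective _).1 inferInstance⟩

lemma LinearProjectiveResolution.finite (F : LinearProjectiveResolution R C)
    (hF : ∀ n, Module.Finite R (F.X n)) : Module.Finite R C :=
  have := hF 0
  Module.Finite.of_surjective F.ε F.surjective

lemma IsSemidualizing.finite (hC : IsSemidualizing R C) : Module.Finite R C :=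
  have ⟨F, hF, _⟩ := hC.exists_resolution
  F.finite hF

lemma IsSemidualizing.eq_zero_of_hom_eq_zero (hC : IsSemidualizing R C)
    (h : ∀ f : C →ₗ[R] M, f = 0) (x : M) : x = 0 := by
  by_contra hx
  have := hC.finite
  obtain ⟨f, hf⟩ := exists_linearMap_ne_zero_of_faithful hC.eq_zero_of_smul hx
  exact hf (h f)

/-- For `M` embedded in an injective `J`, adjunction gives `Hom(C, Hom(M, J)) = Hom(C ⊗ M, J) = 0`.
So `Hom(M, J) = 0`, and the embedding itself is zero. -/
lemma IsSemidualizing.eq_zero_of_tensor_eq_zero (hC : IsSemidualizing R C)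
    (h : ∀ z : C ⊗[R] M, z = 0) (x : M) : x = 0 := by
  obtain ⟨J, _, _, _, i, hi⟩ := exists_injective_embedding R M
  refine hi ?_
  rw [map_zero]
  have := hC.eq_zero_of_hom_eq_zero (M := M →ₗ[R] J) (fun f => by
    ext c x
    have := congrArg (TensorProduct.lift f) (h (c ⊗ₜ x))
    simpa using this) i
  rw [this, LinearMap.zero_apply]

end Definitions

/-! ### Long exact sequence arguments for Ext and Tor, done by chasing elements. -/

namespace LinearProjectiveResolution

variable {R : Type u} [CommRing R] {C : Type u} [AddCommGroup C] [Module R C]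
  (F : LinearProjectiveResolution R C)

/-- `Tor_i(C, N) = 0` for `i ≥ 1`, computed by a projective resolution of `C`. -/
def TorVanish (N : Type u) [AddCommGroup N] [Module R N] : Prop :=
  ∀ n, Function.Exact ((F.d (n + 1)).rTensor N) ((F.d n).rTensor N)

lemma d_comp_d (n : ℕ) : F.d n ∘ₗ F.d (n + 1) = 0 := (F.exact_succ n).linearMap_comp_eq_zero

lemma ε_comp_d : F.ε ∘ₗ F.d 0 = 0 := F.exact_zero.linearMap_comp_eq_zero

variable {F} {A B D : Type u} [AddCommGroup A] [AddCommGroup B] [AddCommGroup D]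
  [Module R A] [Module R B] [Module R D] {i : A →ₗ[R] B} {p : B →ₗ[R] D}

/-- Only `Ext^1(C, A) = 0` is used: it is the obstruction to lifting. -/
lemma ExtVanish.exists_lift (hA : F.ExtVanish A) (hi : Function.Injective i)
    (hip : Function.Exact i p) (hp : Function.Surjective p) (f : C →ₗ[R] D) :
    ∃ g : C →ₗ[R] B, p ∘ₗ g = f := by
  obtain ⟨g, hg⟩ := Module.projective_lifting_property p (f ∘ₗ F.ε) hp
  obtain ⟨h, hh⟩ := hip.exists_lift hi (g ∘ₗ F.d 0) (by
    rw [← LinearMap.comp_assoc, hg, LinearMap.comp_assoc, F.ε_comp_d, LinearMap.comp_zero])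
  obtain ⟨k, hk⟩ := hA 0 h (by
    rw [← LinearMap.cancel_left hi, ← LinearMap.comp_assoc, hh, LinearMap.comp_assoc,
      F.d_comp_d, LinearMap.comp_zero, LinearMap.comp_zero])
  obtain ⟨l, hl⟩ := F.exact_zero.exists_desc F.surjective (g - i ∘ₗ k) (by
    rw [LinearMap.sub_comp, LinearMap.comp_assoc, hk, hh, sub_self])
  refine ⟨l, ?_⟩
  rw [← LinearMap.cancel_right F.surjective, LinearMap.comp_assoc, hl, LinearMap.comp_sub, hg,
    ← LinearMap.comp_assoc, hip.linearMap_comp_eq_zero, LinearMap.zero_comp, sub_zero]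

/-- `Ext^i(C, D)` sits between `Ext^i(C, B)` and `Ext^(i+1)(C, A)`. -/
lemma ExtVanish.of_shortExact (hA : F.ExtVanish A) (hB : F.ExtVanish B)
    (hi : Function.Injective i) (hip : Function.Exact i p) (hp : Function.Surjective p) :
    F.ExtVanish D := by
  intro n f hf
  obtain ⟨g, hg⟩ := Module.projective_lifting_property p f hp
  obtain ⟨h, hh⟩ := hip.exists_lift hi (g ∘ₗ F.d (n + 1)) (by
    rw [← LinearMap.comp_assoc, hg, hf])
  obtain ⟨k, hk⟩ := hA (n + 1) h (by
    rw [← LinearMap.cancel_left hi, ← LinearMap.comp_assoc, hh, LinearMap.comp_assoc,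
      F.d_comp_d, LinearMap.comp_zero, LinearMap.comp_zero])
  obtain ⟨l, hl⟩ := hB n (g - i ∘ₗ k) (by
    rw [LinearMap.sub_comp, LinearMap.comp_assoc, hk, hh, sub_self])
  refine ⟨p ∘ₗ l, ?_⟩
  rw [LinearMap.comp_assoc, hl, LinearMap.comp_sub, hg,
    ← LinearMap.comp_assoc, hip.linearMap_comp_eq_zero, LinearMap.zero_comp, sub_zero]

lemma _root_.LinearMap.rTensor_lTensor_comm {X Y : Type u} [AddCommGroup X] [AddCommGroup Y]
    [Module R X] [Module R Y] (u : X →ₗ[R] Y) (v : A →ₗ[R] B) (z : X ⊗[R] A) :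
    u.rTensor B (v.lTensor X z) = v.lTensor Y (u.rTensor A z) := by
  rw [← LinearMap.comp_apply, ← LinearMap.comp_apply, LinearMap.lTensor_comp_rTensor,
    LinearMap.rTensor_comp_lTensor]

/-- The kernel is the image of `Tor_1(C, D)`. The chase uses flatness of the projective term `F.X
0`. -/
lemma TorVanish.injective_lTensor (hD : F.TorVanish D) (hi : Function.Injective i)
    (hip : Function.Exact i p) (hp : Function.Surjective p) :
    Function.Injective (i.lTensor C) := by
  rw [injective_iff_map_eq_zero]
  intro a ha
  obtain ⟨a, rfl⟩ := LinearMap.rTensor_surjective A F.surjective a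
  rw [← LinearMap.rTensor_lTensor_comm] at ha
  obtain ⟨b, hb⟩ := (rTensor_exact B F.exact_zero F.surjective _).1 ha
  have hpb : (F.d 0).rTensor D (p.lTensor _ b) = 0 := by
    rw [LinearMap.rTensor_lTensor_comm, hb]
    exact (lTensor_exact _ hip hp).apply_apply_eq_zero a
  obtain ⟨e, he⟩ := (hD 0 _).1 hpb
  obtain ⟨e, rfl⟩ := LinearMap.lTensor_surjective _ hp e
  obtain ⟨a', ha'⟩ := (lTensor_exact _ hip hp (b - (F.d 1).rTensor B e)).1 (by
    rw [map_sub, ← he, LinearMap.rTensor_lTensor_comm, sub_self])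
  have h1 : (F.d 0).rTensor A a' = a := by
    refine Module.Flat.lTensor_preserves_injective_linearMap (M := F.X 0) i hi ?_
    rw [← LinearMap.rTensor_lTensor_comm, ha', map_sub, hb, ← LinearMap.comp_apply,
      ← LinearMap.rTensor_comp, F.d_comp_d]
    simp
  rw [← h1]
  exact (rTensor_exact A F.exact_zero F.surjective).apply_apply_eq_zero a'

/-- `Tor_i(C, A)` sits between `Tor_(i+1)(C, D)` and `Tor_i(C, B)`. -/
lemma TorVanish.of_shortExact (hB : F.TorVanish B) (hD : F.TorVanish D)
    (hi : Function.Injective i) (hip : Function.Exact i p) (hp : Function.Surjective p) :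
    F.TorVanish A := by
  intro n a
  constructor
  · intro ha
    obtain ⟨b, hb⟩ := (hB n (i.lTensor _ a)).1 (by
      rw [LinearMap.rTensor_lTensor_comm, ha, map_zero])
    have hpb : (F.d (n + 1)).rTensor D (p.lTensor _ b) = 0 := by
      rw [LinearMap.rTensor_lTensor_comm, hb]
      exact (lTensor_exact _ hip hp).apply_apply_eq_zero a
    obtain ⟨e, he⟩ := (hD (n + 1) _).1 hpb
    obtain ⟨e, rfl⟩ := LinearMap.lTensor_surjective _ hp e
    obtain ⟨a', ha'⟩ := (lTensor_exact _ hip hp (b - (F.d (n + 2)).rTensor B e)).1 (by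
      rw [map_sub, ← he, LinearMap.rTensor_lTensor_comm, sub_self])
    refine ⟨a', Module.Flat.lTensor_preserves_injective_linearMap (M := F.X (n + 1)) i hi ?_⟩
    rw [← LinearMap.rTensor_lTensor_comm, ha', map_sub, hb, ← LinearMap.comp_apply,
      ← LinearMap.rTensor_comp, F.d_comp_d]
    simp
  · rintro ⟨b, rfl⟩
    rw [← LinearMap.comp_apply, ← LinearMap.rTensor_comp, F.d_comp_d]
    simp

end LinearProjectiveResolution

/-! ### Projective modules: the unit and Ext into `C ⊗ P`. -/

section ProjectiveModules

variable {R : Type u} [CommRing R] {C : Type u} [AddCommGroup C] [Module R C]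

lemma LinearMap.exists_finset_support {X N : Type*} [AddCommGroup X] [Module R X]
    [Module.Finite R X] [AddCommGroup N] [Module R N] {ι : Type*} (f : X →ₗ[R] ι →₀ N) :
    ∃ s : Finset ι, ∀ i ∉ s, Finsupp.lapply i ∘ₗ f = 0 := by
  classical
  obtain ⟨t, ht⟩ := (Module.Finite.fg_top : (⊤ : Submodule R X).FG)
  refine ⟨t.biUnion fun x => (f x).support, fun i hi => LinearMap.ext_on ht ?_⟩
  intro x hx
  by_contra hne
  exact hi (Finset.mem_biUnion.2 ⟨x, hx, Finsupp.mem_support_iff.2 hne⟩)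

lemma exists_section_linearCombination (P : Type u) [AddCommGroup P] [Module R P]
    [Module.Projective R P] :
    ∃ (s : P →ₗ[R] P →₀ R) (q : (P →₀ R) →ₗ[R] P), q ∘ₗ s = LinearMap.id :=
  have ⟨s, hs⟩ := Module.projective_def'.1 ‹Module.Projective R P›
  ⟨s, _, hs⟩

-- Each coordinate of a map from `C` to a direct sum of copies of `C` is a homothety, and only
-- finitely many are nonzero because `C` is finitely generated.
open Classical in
lemma IsSemidualizing.tensorUnit_finsupp_bijective (hC : IsSemidualizing R C) (ι : Type u) :
    Function.Bijective (tensorUnit (R := R) C (ι →₀ R)) := by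
  let e := TensorProduct.finsuppScalarRight R R C ι
  have he : ∀ (c : C) (x : ι →₀ R) (i : ι), e (c ⊗ₜ x) i = x i • c :=
    fun c x i => TensorProduct.finsuppScalarRight_apply_tmul_apply c x i
  constructor
  · rw [injective_iff_map_eq_zero]
    intro x hx
    ext i
    refine hC.eq_zero_of_smul _ fun c => ?_
    rw [← he, ← tensorUnit_apply, hx]
    simp
  · intro h
    have := hC.finite
    obtain ⟨s, hs⟩ := (e.toLinearMap ∘ₗ h).exists_finset_support
    choose r hr using fun i => hC.homothety_bijective.2 (Finsupp.lapply i ∘ₗ e.toLinearMap ∘ₗ h)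
    refine ⟨∑ i ∈ s, Finsupp.single i (r i), ?_⟩
    ext c
    apply e.injective
    ext i
    rw [tensorUnit_apply, he]
    have h1 : r i • c = e (h c) i := LinearMap.congr_fun (hr i) c
    rw [Finsupp.finsetSum_apply]
    by_cases hi : i ∈ s
    · rw [Finset.sum_eq_single i (by simp +contextual) (by simp [hi]), Finsupp.single_eq_same, h1]
    · rw [Finset.sum_eq_zero, zero_smul]
      · exact (LinearMap.congr_fun (hs i hi) c).symm
      · intro j hj
        rw [Finsupp.single_eq_of_ne]
        rintro rfl
        exact hi hj

lemma IsSemidualizing.tensorUnit_bijective_of_projective (hC : IsSemidualizing R C)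
    (P : Type u) [AddCommGroup P] [Module R P] [Module.Projective R P] :
    Function.Bijective (tensorUnit (R := R) C P) := by
  obtain ⟨s, q, hsq⟩ := exists_section_linearCombination (R := R) P
  have hfree := hC.tensorUnit_finsupp_bijective P
  have hq : ∀ x, q (s x) = x := LinearMap.congr_fun hsq
  constructor
  · rw [injective_iff_map_eq_zero]
    intro x hx
    rw [← hq x, (injective_iff_map_eq_zero _).1 hfree.1 (s x), map_zero]
    rw [← lTensor_comp_tensorUnit, hx, LinearMap.comp_zero]
  · intro h
    obtain ⟨x, hx⟩ := hfree.2 (s.lTensor C ∘ₗ h)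
    refine ⟨q x, ?_⟩
    rw [← lTensor_comp_tensorUnit, hx, ← LinearMap.comp_assoc, ← LinearMap.lTensor_comp, hsq,
      LinearMap.lTensor_id, LinearMap.id_comp]

-- For `P` free, a cocycle on a finitely generated term has finitely many nonzero coordinates, each
-- a coboundary; a projective `P` is a retract of a free module.
open Classical in
lemma LinearProjectiveResolution.ExtVanish.tensor_projective {F : LinearProjectiveResolution R C}
    (hfin : ∀ n, Module.Finite R (F.X n)) (hF : F.ExtVanish C)
    (P : Type u) [AddCommGroup P] [Module R P] [Module.Projective R P] :
    F.ExtVanish (C ⊗[R] P) := by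
  intro n f hf
  obtain ⟨s, q, hsq⟩ := exists_section_linearCombination (R := R) P
  let e := TensorProduct.finsuppScalarRight R R C P
  let φ : F.X (n + 1) →ₗ[R] P →₀ C := e.toLinearMap ∘ₗ s.lTensor C ∘ₗ f
  obtain ⟨t, ht⟩ := φ.exists_finset_support
  choose g hg using fun i => hF n (Finsupp.lapply i ∘ₗ φ) (by
    simp only [φ, LinearMap.comp_assoc, hf, LinearMap.comp_zero])
  let G : F.X n →ₗ[R] P →₀ C := ∑ i ∈ t, Finsupp.lsingle i ∘ₗ g i
  have hG : G ∘ₗ F.d n = φ := by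
    ext x i
    have h1 : ∀ j, g j (F.d n x) = φ x j := fun j => LinearMap.congr_fun (hg j) x
    simp only [G, LinearMap.comp_apply, LinearMap.sum_apply, Finsupp.finsetSum_apply,
      Finsupp.lsingle_apply, h1]
    by_cases hi : i ∈ t
    · rw [Finset.sum_eq_single i (by simp +contextual) (by simp [hi]), Finsupp.single_eq_same]
    · rw [Finset.sum_eq_zero]
      · exact (LinearMap.congr_fun (ht i hi) x).symm
      · intro j hj
        rw [Finsupp.single_eq_of_ne]
        rintro rfl
        exact hi hj
  refine ⟨q.lTensor C ∘ₗ e.symm.toLinearMap ∘ₗ G, ?_⟩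
  rw [LinearMap.comp_assoc, LinearMap.comp_assoc, hG]
  ext x
  simp only [φ, LinearMap.comp_apply, LinearEquiv.coe_coe, LinearEquiv.symm_apply_apply]
  rw [← LinearMap.comp_apply, ← LinearMap.lTensor_comp, hsq]
  simp

end ProjectiveModules

/-! ### Injective modules: the counit and Tor with `Hom(C, I)`. -/

section InjectiveModules

variable {R : Type u} [CommRing R] (F C I : Type u) [AddCommGroup F] [Module R F]
  [AddCommGroup C] [Module R C] [AddCommGroup I] [Module R I]

/-- The Hom evaluation map `F ⊗ Hom(C, I) → Hom(Hom(F, C), I)`. -/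
noncomputable def homEvaluation : F ⊗[R] (C →ₗ[R] I) →ₗ[R] (F →ₗ[R] C) →ₗ[R] I :=
  TensorProduct.lift (LinearMap.mk₂ R (fun x h => h ∘ₗ LinearMap.applyₗ x)
    (by intros; ext; simp) (by intros; ext; simp) (by intros; ext; simp) (by intros; ext; simp))

variable {F C I}

@[simp] lemma homEvaluation_tmul (x : F) (h : C →ₗ[R] I) (φ : F →ₗ[R] C) :
    homEvaluation F C I (x ⊗ₜ h) φ = h (φ x) := rfl

lemma homEvaluation_rTensor {F' : Type u} [AddCommGroup F'] [Module R F'] (d : F →ₗ[R] F')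
    (z : F ⊗[R] (C →ₗ[R] I)) :
    homEvaluation F' C I (d.rTensor _ z) = homEvaluation F C I z ∘ₗ LinearMap.lcomp R C d := by
  induction z with
  | zero => simp
  | add x y hx hy => simp only [map_add, hx, hy, LinearMap.add_comp]
  | tmul x h => ext φ; simp

variable (F C I) in
lemma homEvaluation_bijective [Module.Finite R F] [Module.Projective R F] :
    Function.Bijective (homEvaluation (R := R) F C I) := by
  obtain ⟨n, f, g, -, -, hfg⟩ := Module.Finite.exists_comp_eq_id_of_projective R F
  -- `b` and `b'` form a finite dual basis of `F`, from which the inverse is written down.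
  let b : Fin n → F := fun j => f (Pi.single j 1)
  let b' : Fin n → F →ₗ[R] R := fun j => LinearMap.proj j ∘ₗ g
  have hb : ∀ x, ∑ j, b' j x • b j = x := by
    intro x
    conv_rhs => rw [← LinearMap.id_apply (R := R) x, ← hfg, LinearMap.comp_apply,
      pi_eq_sum_univ' (g x), map_sum]
    simp [b, b']
  let inv : ((F →ₗ[R] C) →ₗ[R] I) →ₗ[R] F ⊗[R] (C →ₗ[R] I) :=
    ∑ j, TensorProduct.mk R F _ (b j) ∘ₗ LinearMap.lcomp R I (LinearMap.smulRightₗ (b' j))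
  refine Function.bijective_iff_has_inverse.2 ⟨inv, ?_, ?_⟩
  · intro z
    induction z with
    | zero => simp
    | add x y hx hy => simp only [map_add, hx, hy]
    | tmul x h =>
      conv_rhs => rw [← hb x, TensorProduct.sum_tmul]
      simp only [inv, LinearMap.sum_apply]
      refine Finset.sum_congr rfl fun j _ => ?_
      rw [TensorProduct.smul_tmul]
      simp only [LinearMap.comp_apply, TensorProduct.mk_apply]
      congr 1
      ext c
      simp
  · intro Λ
    ext φ
    simp only [inv, LinearMap.sum_apply, map_sum, LinearMap.comp_apply, TensorProduct.mk_apply,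
      homEvaluation_tmul]
    simp only [LinearMap.lcomp_apply]
    rw [← map_sum]
    congr 1
    ext x
    conv_rhs => rw [← hb x, map_sum]
    simp

/-- Hom evaluation identifies `F ⊗ Hom(C, I)` termwise with `Hom(Hom(F, C), I)`, and `Hom(-, I)` is
exact, so `Tor_i(C, Hom(C, I))` is dual to `Ext^i(C, C)`. -/
lemma LinearProjectiveResolution.ExtVanish.torVanish_hom_injective
    {F : LinearProjectiveResolution R C} (hfin : ∀ n, Module.Finite R (F.X n))
    (hF : F.ExtVanish C) [Module.Injective R I] : F.TorVanish (C →ₗ[R] I) := by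
  intro n z
  constructor
  · intro hz
    have hex : Function.Exact (LinearMap.lcomp R C (F.d n)) (LinearMap.lcomp R C (F.d (n + 1))) := by
      intro f
      refine ⟨fun hf => hF n f hf, ?_⟩
      rintro ⟨g, rfl⟩
      ext x
      simp [(F.exact_succ n).apply_apply_eq_zero x]
    obtain ⟨Λ, hΛ⟩ := hex.exists_desc_of_injective (homEvaluation _ C I z) (by
      rw [← homEvaluation_rTensor, hz, map_zero])
    obtain ⟨w, rfl⟩ := (homEvaluation_bijective (F.X (n + 2)) C I).2 Λ
    refine ⟨w, (homEvaluation_bijective (F.X (n + 1)) C I).1 ?_⟩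
    rw [homEvaluation_rTensor, hΛ]
  · rintro ⟨w, rfl⟩
    rw [← LinearMap.comp_apply, ← LinearMap.rTensor_comp, F.d_comp_d]
    simp

/-- By finite presentation of `C`, hom evaluation gives `C ⊗ Hom(C, I) ≅ Hom(Hom(C, C), I)`. The
homothety isomorphism makes the target `Hom(R, I) ≅ I`, and the composite, evaluation at the
identity, is the counit. -/
lemma IsSemidualizing.homCounit_bijective_of_injective (hC : IsSemidualizing R C)
    (I : Type u) [AddCommGroup I] [Module R I] [Module.Injective R I] :
    Function.Bijective (homCounit (R := R) C I) := by
  obtain ⟨F, hfin, hF⟩ := hC.exists_resolution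
  have hinj : Function.Injective (LinearMap.lcomp R C F.ε) := fun f g hfg =>
    (LinearMap.cancel_right F.surjective).1 hfg
  have hex : Function.Exact (LinearMap.lcomp R C F.ε) (LinearMap.lcomp R C (F.d 0)) := by
    intro f
    constructor
    · exact fun hf => F.exact_zero.exists_desc F.surjective f hf
    · rintro ⟨g, rfl⟩
      ext x
      simp [F.exact_zero.apply_apply_eq_zero x]
  have hb : Function.Bijective (homEvaluation (R := R) C C I) := by
    constructor
    · rw [injective_iff_map_eq_zero]
      intro z hz
      obtain ⟨z, rfl⟩ := LinearMap.rTensor_surjective _ F.surjective z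
      rw [homEvaluation_rTensor] at hz
      obtain ⟨Λ, hΛ⟩ := hex.exists_desc_of_injective _ hz
      obtain ⟨w, rfl⟩ := (homEvaluation_bijective (F.X 1) C I).2 Λ
      rw [← homEvaluation_rTensor] at hΛ
      rw [← (homEvaluation_bijective (F.X 0) C I).1 hΛ]
      exact (rTensor_exact _ F.exact_zero F.surjective).apply_apply_eq_zero w
    · intro Λ
      obtain ⟨Λ', hΛ'⟩ := Module.Injective.extension_property R I _ _ _ hinj Λ
      obtain ⟨w, rfl⟩ := (homEvaluation_bijective (F.X 0) C I).2 Λ'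
      exact ⟨F.ε.rTensor _ w, by rw [homEvaluation_rTensor, hΛ']⟩
  have hν : ∀ z, homCounit C I z = homEvaluation C C I z (LinearMap.id : C →ₗ[R] C) := by
    intro z
    induction z with
    | zero => simp
    | add x y hx hy => simp only [map_add, hx, hy, LinearMap.add_apply]
    | tmul c h => simp
  have hsmul : ∀ (Λ : (C →ₗ[R] C) →ₗ[R] I) (r : R),
      Λ (LinearMap.lsmul R C r) = r • Λ (LinearMap.id : C →ₗ[R] C) := by
    intro Λ r
    rw [← map_smul]
    congr 1
  constructor
  · rw [injective_iff_map_eq_zero]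
    intro z hz
    refine (injective_iff_map_eq_zero _).1 hb.1 z ?_
    ext f
    obtain ⟨r, rfl⟩ := hC.homothety_bijective.2 f
    rw [hsmul, ← hν, hz, smul_zero, LinearMap.zero_apply]
  · intro x
    let e := LinearEquiv.ofBijective (LinearMap.lsmul R C) hC.homothety_bijective
    obtain ⟨z, hz⟩ := hb.2 (LinearMap.toSpanSingleton R I x ∘ₗ e.symm.toLinearMap)
    refine ⟨z, ?_⟩
    rw [hν, hz]
    have : e.symm (LinearMap.id : C →ₗ[R] C) = 1 := by
      rw [LinearEquiv.symm_apply_eq]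
      ext c
      simp [e]
    simp [this]

end InjectiveModules

/-! ### Dimension shifting, induction on dimension, and projective resolutions. -/

section ProjectiveDimension

variable {R : Type u} [CommRing R]

lemma hasProjectiveDimensionLT_of_linearEquiv {M N : Type u} [AddCommGroup M] [Module R M]
    [AddCommGroup N] [Module R N] (e : M ≃ₗ[R] N) {k : ℕ}
    (h : HasProjectiveDimensionLT (ModuleCat.of R M) k) :
    HasProjectiveDimensionLT (ModuleCat.of R N) k :=
  hasProjectiveDimensionLT_of_iso e.toModuleIso k

lemma hasInjectiveDimensionLT_of_linearEquiv {M N : Type u} [AddCommGroup M] [Module R M]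
    [AddCommGroup N] [Module R N] (e : M ≃ₗ[R] N) {k : ℕ}
    (h : HasInjectiveDimensionLT (ModuleCat.of R M) k) :
    HasInjectiveDimensionLT (ModuleCat.of R N) k :=
  hasInjectiveDimensionLT_of_iso e.toModuleIso k

lemma Module.Injective.of_linearEquiv {M N : Type u} [AddCommGroup M] [Module R M]
    [AddCommGroup N] [Module R N] (e : M ≃ₗ[R] N) [Module.Injective R M] :
    Module.Injective R N :=
  ((Module.Baer.congr e).1 (Module.Baer.of_injective ‹_›)).injective

lemma hasProjectiveDimensionLT_zero_iff_subsingleton {M : Type u} [AddCommGroup M] [Module R M] :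
    HasProjectiveDimensionLT (ModuleCat.of R M) 0 ↔ Subsingleton M := by
  rw [hasProjectiveDimensionLT_zero_iff_isZero, ModuleCat.isZero_iff_subsingleton]

lemma hasInjectiveDimensionLT_zero_iff_subsingleton {M : Type u} [AddCommGroup M] [Module R M] :
    HasInjectiveDimensionLT (ModuleCat.of R M) 0 ↔ Subsingleton M := by
  rw [hasInjectiveDimensionLT_zero_iff_isZero, ModuleCat.isZero_iff_subsingleton]

lemma hasProjectiveDimensionLT_one_iff {M : Type u} [AddCommGroup M] [Module R M] :
    HasProjectiveDimensionLT (ModuleCat.of R M) 1 ↔ Module.Projective R M := by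
  rw [← projective_iff_hasProjectiveDimensionLT_one, IsProjective.iff_projective]

lemma hasInjectiveDimensionLT_one_iff {M : Type u} [AddCommGroup M] [Module R M] :
    HasInjectiveDimensionLT (ModuleCat.of R M) 1 ↔ Module.Injective R M := by
  rw [← injective_iff_hasInjectiveDimensionLT_one, Module.injective_iff_injective_object]

lemma hasProjectiveDimensionLT_add_two_iff {P M : Type u} [AddCommGroup P] [Module R P]
    [AddCommGroup M] [Module R M] [Module.Projective R P] {f : P →ₗ[R] M}
    (hf : Function.Surjective f) (k : ℕ) :
    HasProjectiveDimensionLT (ModuleCat.of R M) (k + 2) ↔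
      HasProjectiveDimensionLT (ModuleCat.of R (LinearMap.ker f)) (k + 1) :=
  (LinearMap.shortExact_shortComplexKer hf).hasProjectiveDimensionLT_X₃_iff k
    ((IsProjective.iff_projective P).1 inferInstance)

lemma hasInjectiveDimensionLT_add_two_iff {M I : Type u} [AddCommGroup I] [Module R I]
    [AddCommGroup M] [Module R M] [Module.Injective R I] {f : M →ₗ[R] I}
    (hf : Function.Injective f) (k : ℕ) :
    HasInjectiveDimensionLT (ModuleCat.of R M) (k + 2) ↔
      HasInjectiveDimensionLT (ModuleCat.of R (I ⧸ LinearMap.range f)) (k + 1) := by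
  have hS := ModuleCat.shortComplex_shortExact
    (ModuleCat.shortComplexOfCompEqZero f (LinearMap.range f).mkQ (LinearMap.range_mkQ_comp f))
    (LinearMap.exact_map_mkQ_range f) hf (Submodule.mkQ_surjective _)
  exact (hS.hasInjectiveDimensionLT_X₃_iff k
    ((Module.injective_iff_injective_object R I).1 inferInstance)).symm

lemma hasProjectiveDimensionLT_induction
    {motive : ∀ (M : Type u) [AddCommGroup M] [Module R M], Prop}
    (projective : ∀ (P : Type u) [AddCommGroup P] [Module R P] [Module.Projective R P], motive P)
    (step : ∀ (P M : Type u) [AddCommGroup P] [Module R P] [AddCommGroup M] [Module R M]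
      [Module.Projective R P] (f : P →ₗ[R] M), Function.Surjective f →
        motive (LinearMap.ker f) → motive M)
    (k : ℕ) : ∀ (M : Type u) [AddCommGroup M] [Module R M],
      HasProjectiveDimensionLT (ModuleCat.of R M) k → motive M := by
  have key : ∀ (k : ℕ) (M : Type u) [AddCommGroup M] [Module R M],
      HasProjectiveDimensionLT (ModuleCat.of R M) (k + 1) → motive M := by
    intro k
    induction k with
    | zero =>
      intro M _ _ h
      have := hasProjectiveDimensionLT_one_iff.1 h
      exact projective M
    | succ k ih =>
      intro M _ _ h
      have hs := Finsupp.linearCombination_id_surjective R M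
      exact step _ M _ hs (ih _ ((hasProjectiveDimensionLT_add_two_iff hs k).1 h))
  intro M _ _ h
  -- Weakening the bound by one absorbs the zero module into the projective case.
  exact key k M (hasProjectiveDimensionLT_of_ge _ k _ (Nat.le_succ k))

lemma hasInjectiveDimensionLT_induction
    {motive : ∀ (M : Type u) [AddCommGroup M] [Module R M], Prop}
    (injective : ∀ (I : Type u) [AddCommGroup I] [Module R I] [Module.Injective R I], motive I)
    (step : ∀ (M I : Type u) [AddCommGroup M] [Module R M] [AddCommGroup I] [Module R I]
      [Module.Injective R I] (f : M →ₗ[R] I), Function.Injective f →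
        motive (I ⧸ LinearMap.range f) → motive M)
    (k : ℕ) : ∀ (M : Type u) [AddCommGroup M] [Module R M],
      HasInjectiveDimensionLT (ModuleCat.of R M) k → motive M := by
  have key : ∀ (k : ℕ) (M : Type u) [AddCommGroup M] [Module R M],
      HasInjectiveDimensionLT (ModuleCat.of R M) (k + 1) → motive M := by
    intro k
    induction k with
    | zero =>
      intro M _ _ h
      have := hasInjectiveDimensionLT_one_iff.1 h
      exact injective M
    | succ k ih =>
      intro M _ _ h
      obtain ⟨I, _, _, _, i, hi⟩ := exists_injective_embedding R M
      exact step M I i hi (ih _ ((hasInjectiveDimensionLT_add_two_iff hi k).1 h))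
  intro M _ _ h
  exact key k M (hasInjectiveDimensionLT_of_ge _ k _ (Nat.le_succ k))

namespace LinearProjectiveResolution

/-- The resolution of a zero module by zero modules. -/
noncomputable def ofSubsingleton (R : Type u) [CommRing R] (M : Type u) [AddCommGroup M]
    [Module R M] [Subsingleton M] : LinearProjectiveResolution R M where
  X _ := ModuleCat.of R PUnit.{u + 1}
  d _ := 0
  ε := 0
  projective _ := inferInstanceAs (Module.Projective R PUnit.{u + 1})
  surjective _ := ⟨0, Subsingleton.elim _ _⟩
  exact_zero _ := ⟨fun _ => ⟨0, rfl⟩, fun _ => Subsingleton.elim _ _⟩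
  exact_succ _ _ := ⟨fun _ => ⟨0, rfl⟩, fun _ => rfl⟩

variable {P M : Type u} [AddCommGroup P] [Module R P] [AddCommGroup M] [Module R M]

/-- Prepend a surjection from a projective module to a resolution of its kernel. -/
noncomputable def cons [Module.Projective R P] (f : P →ₗ[R] M) (hf : Function.Surjective f)
    (F : LinearProjectiveResolution R (LinearMap.ker f)) : LinearProjectiveResolution R M where
  X n := Nat.casesOn n (ModuleCat.of R P) F.X
  d n := match n with
    | 0 => (LinearMap.ker f).subtype ∘ₗ F.ε
    | n + 1 => F.d n
  ε := f
  projective n := match n with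
    | 0 => ‹Module.Projective R P›
    | n + 1 => F.projective n
  surjective := hf
  exact_zero := by
    intro x
    constructor
    · intro hx
      obtain ⟨y, hy⟩ := F.surjective ⟨x, hx⟩
      exact ⟨y, congrArg Subtype.val hy⟩
    · rintro ⟨y, rfl⟩
      exact (F.ε y).2
  exact_succ n := match n with
    | 0 => fun x => by
      rw [← F.exact_zero x]
      exact (Subtype.ext_iff (a1 := F.ε x) (a2 := 0)).symm
    | n + 1 => F.exact_succ n

/-- The resolution of the first syzygy. -/
noncomputable def tail (F : LinearProjectiveResolution R M) :
    LinearProjectiveResolution R (LinearMap.ker F.ε) where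
  X n := F.X (n + 1)
  d n := F.d (n + 1)
  ε := (F.d 0).codRestrict _ fun x => F.exact_zero.apply_apply_eq_zero x
  projective n := F.projective (n + 1)
  surjective := by
    rintro ⟨x, hx⟩
    obtain ⟨y, hy⟩ := (F.exact_zero x).1 hx
    exact ⟨y, Subtype.ext hy⟩
  exact_zero := by
    intro x
    rw [← F.exact_succ 0 x, Subtype.ext_iff]
    rfl
  exact_succ n := F.exact_succ (n + 1)

end LinearProjectiveResolution

lemma hasProjectiveDimensionLT_iff_exists_resolution (k : ℕ) :
    ∀ (M : Type u) [AddCommGroup M] [Module R M],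
      HasProjectiveDimensionLT (ModuleCat.of R M) k ↔
        ∃ F : LinearProjectiveResolution R M, ∀ n, k ≤ n → Subsingleton (F.X n) := by
  induction k with
  | zero =>
    intro M _ _
    rw [hasProjectiveDimensionLT_zero_iff_subsingleton]
    constructor
    · intro h
      exact ⟨.ofSubsingleton R M, fun n _ => inferInstanceAs (Subsingleton PUnit)⟩
    · rintro ⟨F, hF⟩
      have := hF 0 le_rfl
      exact F.surjective.subsingleton
  | succ k ih =>
    intro M _ _
    constructor
    · intro h
      have cons_case : ∀ (P : Type u) [AddCommGroup P] [Module R P] [Module.Projective R P]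
          (f : P →ₗ[R] M) (_ : Function.Surjective f)
          (_ : HasProjectiveDimensionLT (ModuleCat.of R (LinearMap.ker f)) k),
          ∃ F : LinearProjectiveResolution R M, ∀ n, k + 1 ≤ n → Subsingleton (F.X n) := by
        intro P _ _ _ f hf hk
        obtain ⟨F, hF⟩ := (ih _).1 hk
        refine ⟨F.cons f hf, fun n hn => ?_⟩
        obtain _ | n := n
        · omega
        · exact hF n (by omega)
      -- Dimension shifting starts at bound 2, so a projective `M` is treated apart: it covers
      -- itself, with zero kernel.
      obtain _ | k := k
      · have := hasProjectiveDimensionLT_one_iff.1 h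
        refine cons_case M LinearMap.id Function.surjective_id ?_
        rw [hasProjectiveDimensionLT_zero_iff_subsingleton, LinearMap.ker_id]
        infer_instance
      · have hs := Finsupp.linearCombination_id_surjective R M
        exact cons_case _ _ hs ((hasProjectiveDimensionLT_add_two_iff hs k).1 h)
    · rintro ⟨F, hF⟩
      have hk := (ih (LinearMap.ker F.ε)).2 ⟨F.tail, fun n hn => hF (n + 1) (by omega)⟩
      have h0 := hasProjectiveDimensionLT_one_iff.2 (F.projective 0)
      exact (LinearMap.shortExact_shortComplexKer F.surjective).hasProjectiveDimensionLT_X₃ k hk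
        (hasProjectiveDimensionLT_of_ge _ 1 _ (by omega))

end ProjectiveDimension

/-! ### Injective resolutions and injective dimension. -/

section InjectiveDimension

/-- An injective resolution of `M`, as a sequence of linear maps. -/
structure LinearInjectiveResolution (R : Type u) [CommRing R] (M : Type u) [AddCommGroup M]
    [Module R M] where
  X : ℕ → ModuleCat.{u} R
  d : ∀ n, X n →ₗ[R] X (n + 1)
  η : M →ₗ[R] X 0
  injective : ∀ n, Module.Injective R (X n)
  η_injective : Function.Injective η
  exact_zero : Function.Exact η (d 0)
  exact_succ : ∀ n, Function.Exact (d n) (d (n + 1))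

attribute [instance] LinearInjectiveResolution.injective

variable {R : Type u} [CommRing R]

lemma Module.Injective.of_subsingleton (M : Type u) [AddCommGroup M] [Module R M]
    [Subsingleton M] : Module.Injective R M :=
  ⟨fun _ _ _ _ _ _ _ _ _ => ⟨0, fun _ => Subsingleton.elim _ _⟩⟩

namespace LinearInjectiveResolution

/-- The resolution of a zero module by zero modules. -/
noncomputable def ofSubsingleton (R : Type u) [CommRing R] (M : Type u) [AddCommGroup M]
    [Module R M] [Subsingleton M] : LinearInjectiveResolution R M where
  X _ := ModuleCat.of R PUnit.{u + 1}
  d _ := 0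
  η := 0
  injective _ := Module.Injective.of_subsingleton PUnit.{u + 1}
  η_injective := Function.injective_of_subsingleton _
  exact_zero _ := ⟨fun _ => ⟨0, rfl⟩, fun _ => rfl⟩
  exact_succ _ _ := ⟨fun _ => ⟨0, rfl⟩, fun _ => rfl⟩

variable {I M : Type u} [AddCommGroup I] [Module R I] [AddCommGroup M] [Module R M]

/-- Prepend an embedding into an injective module to a resolution of its cokernel. -/
noncomputable def cons [Module.Injective R I] (f : M →ₗ[R] I) (hf : Function.Injective f)
    (F : LinearInjectiveResolution R (I ⧸ LinearMap.range f)) :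
    LinearInjectiveResolution R M where
  X n := Nat.casesOn n (ModuleCat.of R I) F.X
  d n := match n with
    | 0 => F.η ∘ₗ (LinearMap.range f).mkQ
    | n + 1 => F.d n
  η := f
  injective n := match n with
    | 0 => ‹Module.Injective R I›
    | n + 1 => F.injective n
  η_injective := hf
  exact_zero := by
    intro x
    rw [← LinearMap.exact_map_mkQ_range f x]
    exact map_eq_zero_iff F.η F.η_injective
  exact_succ n := match n with
    | 0 => fun x => by
      rw [F.exact_zero x]
      constructor
      · rintro ⟨y, rfl⟩
        obtain ⟨z, rfl⟩ := Submodule.mkQ_surjective _ y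
        exact ⟨z, rfl⟩
      · rintro ⟨z, rfl⟩
        exact ⟨_, rfl⟩
    | n + 1 => F.exact_succ n

/-- The resolution of the first cosyzygy. -/
noncomputable def tail (F : LinearInjectiveResolution R M) :
    LinearInjectiveResolution R (F.X 0 ⧸ LinearMap.range F.η) where
  X n := F.X (n + 1)
  d n := F.d (n + 1)
  η := (LinearMap.range F.η).liftQ (F.d 0) (by
    rintro _ ⟨x, rfl⟩
    exact F.exact_zero.apply_apply_eq_zero x)
  injective n := F.injective (n + 1)
  η_injective := by
    rw [injective_iff_map_eq_zero]
    intro y hy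
    obtain ⟨x, rfl⟩ := Submodule.mkQ_surjective _ y
    exact (Submodule.Quotient.mk_eq_zero _).2 ((F.exact_zero x).1 hy)
  exact_zero := by
    intro x
    rw [F.exact_succ 0 x]
    constructor
    · rintro ⟨y, rfl⟩
      exact ⟨Submodule.Quotient.mk y, rfl⟩
    · rintro ⟨y, rfl⟩
      obtain ⟨z, rfl⟩ := Submodule.mkQ_surjective _ y
      exact ⟨z, rfl⟩
  exact_succ n := F.exact_succ (n + 1)

end LinearInjectiveResolution

lemma hasInjectiveDimensionLT_iff_exists_resolution (k : ℕ) :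
    ∀ (M : Type u) [AddCommGroup M] [Module R M],
      HasInjectiveDimensionLT (ModuleCat.of R M) k ↔
        ∃ F : LinearInjectiveResolution R M, ∀ n, k ≤ n → Subsingleton (F.X n) := by
  induction k with
  | zero =>
    intro M _ _
    rw [hasInjectiveDimensionLT_zero_iff_subsingleton]
    constructor
    · intro h
      exact ⟨.ofSubsingleton R M, fun n _ => inferInstanceAs (Subsingleton PUnit)⟩
    · rintro ⟨F, hF⟩
      have := hF 0 le_rfl
      exact F.η_injective.subsingleton
  | succ k ih =>
    intro M _ _
    constructor
    · intro h
      have cons_case : ∀ (I : Type u) [AddCommGroup I] [Module R I] [Module.Injective R I]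
          (f : M →ₗ[R] I) (_ : Function.Injective f)
          (_ : HasInjectiveDimensionLT (ModuleCat.of R (I ⧸ LinearMap.range f)) k),
          ∃ F : LinearInjectiveResolution R M, ∀ n, k + 1 ≤ n → Subsingleton (F.X n) := by
        intro I _ _ _ f hf hk
        obtain ⟨F, hF⟩ := (ih _).1 hk
        refine ⟨F.cons f hf, fun n hn => ?_⟩
        obtain _ | n := n
        · omega
        · exact hF n (by omega)
      obtain _ | k := k
      · have := hasInjectiveDimensionLT_one_iff.1 h
        refine cons_case M LinearMap.id Function.injective_id ?_
        rw [hasInjectiveDimensionLT_zero_iff_subsingleton, LinearMap.range_id]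
        infer_instance
      · obtain ⟨I, _, _, _, i, hi⟩ := exists_injective_embedding R M
        exact cons_case I i hi ((hasInjectiveDimensionLT_add_two_iff hi k).1 h)
    · rintro ⟨F, hF⟩
      have hk := (ih (F.X 0 ⧸ LinearMap.range F.η)).2 ⟨F.tail, fun n hn => hF (n + 1) (by omega)⟩
      have h0 := hasInjectiveDimensionLT_one_iff.2 (F.injective 0)
      have hS := ModuleCat.shortComplex_shortExact
        (ModuleCat.shortComplexOfCompEqZero F.η (LinearMap.range F.η).mkQ
          (LinearMap.range_mkQ_comp F.η))
        (LinearMap.exact_map_mkQ_range F.η) F.η_injective (Submodule.mkQ_surjective _)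
      exact hS.hasInjectiveDimensionLT_X₁ k hk (hasInjectiveDimensionLT_of_ge _ 1 _ (by omega))

end InjectiveDimension

/-! ### Auslander and Bass classes, and the comparison of dimensions. -/

section FoxbyClasses

variable {R : Type u} [CommRing R] {C : Type u} [AddCommGroup C] [Module R C]

lemma IsSemidualizing.surjective_of_lTensor (hC : IsSemidualizing R C) {A B : Type u}
    [AddCommGroup A] [Module R A] [AddCommGroup B] [Module R B] {f : A →ₗ[R] B}
    (h : Function.Surjective (f.lTensor C)) : Function.Surjective f := by
  intro b
  have hz : ∀ z : C ⊗[R] (B ⧸ LinearMap.range f), z = 0 := by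
    intro z
    obtain ⟨z, rfl⟩ := LinearMap.lTensor_surjective C (Submodule.mkQ_surjective _) z
    obtain ⟨w, rfl⟩ := h z
    rw [← LinearMap.comp_apply, ← LinearMap.lTensor_comp, LinearMap.range_mkQ_comp]
    simp
  exact (Submodule.Quotient.mk_eq_zero _).1 (hC.eq_zero_of_tensor_eq_zero hz
    (Submodule.Quotient.mk b))

lemma IsSemidualizing.injective_of_comp (hC : IsSemidualizing R C) {A B : Type u}
    [AddCommGroup A] [Module R A] [AddCommGroup B] [Module R B] {f : A →ₗ[R] B}
    (h : ∀ g : C →ₗ[R] A, f ∘ₗ g = 0 → g = 0) : Function.Injective f := by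
  rw [injective_iff_map_eq_zero]
  intro a ha
  have hz : ∀ g : C →ₗ[R] LinearMap.ker f, g = 0 := by
    intro g
    have hg := h ((LinearMap.ker f).subtype ∘ₗ g) (by
      rw [← LinearMap.comp_assoc, LinearMap.comp_ker_subtype, LinearMap.zero_comp])
    ext c
    exact LinearMap.congr_fun hg c
  exact congrArg Subtype.val (hC.eq_zero_of_hom_eq_zero hz ⟨a, ha⟩)

lemma LinearMap.exact_subtype_ker {A B : Type u} [AddCommGroup A] [Module R A] [AddCommGroup B]
    [Module R B] (f : A →ₗ[R] B) : Function.Exact (LinearMap.ker f).subtype f :=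
  fun x => by simp

/-- Tensoring with `C` keeps injective the kernel inclusion of any surjection onto `M`,
provided that it does so for one surjection from a projective module. -/
lemma injective_lTensor_ker_of_projective {P M N : Type u} [AddCommGroup P] [Module R P]
    [AddCommGroup M] [Module R M] [AddCommGroup N] [Module R N] [Module.Projective R P]
    {f : P →ₗ[R] M} (hf : Function.Surjective f)
    (h : Function.Injective ((LinearMap.ker f).subtype.lTensor C))
    (g : N →ₗ[R] M) (hg : Function.Surjective g) :
    Function.Injective ((LinearMap.ker g).subtype.lTensor C) := by
  obtain ⟨l, hl⟩ := Module.projective_lifting_property g f hg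
  have hl' : ∀ x, g (l x) = f x := LinearMap.congr_fun hl
  -- As in Schanuel's lemma, `0 → ker f → P × ker g → N → 0` is exact. If `z` dies in `C ⊗ N`, then
  -- `(0, z)` comes from some `w` in `C ⊗ ker f`; the first coordinate and `h` force `w = 0`.
  let κ : LinearMap.ker f →ₗ[R] P × LinearMap.ker g :=
    (LinearMap.ker f).subtype.prod
      (-((l ∘ₗ (LinearMap.ker f).subtype).codRestrict (LinearMap.ker g) fun x => by
        rw [LinearMap.mem_ker, LinearMap.comp_apply, hl']
        exact x.2))
  let q : P × LinearMap.ker g →ₗ[R] N := l.coprod (LinearMap.ker g).subtype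
  have hq : Function.Surjective q := by
    intro n
    obtain ⟨p, hp⟩ := hf (g n)
    exact ⟨(p, ⟨n - l p, by rw [LinearMap.mem_ker, map_sub, hl', hp, sub_self]⟩), by simp [q]⟩
  have hex : Function.Exact κ q := by
    rintro ⟨p, n⟩
    constructor
    · intro hpn
      have hpn' : l p + n = 0 := hpn
      refine ⟨⟨p, ?_⟩, ?_⟩
      · rw [LinearMap.mem_ker, ← hl', eq_neg_of_add_eq_zero_left hpn', map_neg, neg_eq_zero]
        exact n.2
      · refine Prod.ext rfl (Subtype.ext ?_)
        exact (eq_neg_of_add_eq_zero_right hpn').symm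
    · rintro ⟨x, hx⟩
      rw [← hx]
      simp [κ, q]
  rw [injective_iff_map_eq_zero]
  intro z hz
  obtain ⟨w, hw⟩ := (lTensor_exact C hex hq ((LinearMap.inr R P (LinearMap.ker g)).lTensor C z)).1
    (by rw [← LinearMap.comp_apply, ← LinearMap.lTensor_comp, LinearMap.coprod_inr, hz])
  have hw0 : w = 0 := by
    apply (injective_iff_map_eq_zero _).1 h
    have h1 := congrArg ((LinearMap.fst R P (LinearMap.ker g)).lTensor C) hw
    rw [← LinearMap.comp_apply, ← LinearMap.lTensor_comp, ← LinearMap.comp_apply,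
      ← LinearMap.lTensor_comp, LinearMap.fst_comp_inr, LinearMap.lTensor_zero,
      LinearMap.fst_prod] at h1
    exact h1
  have h2 := congrArg ((LinearMap.snd R P (LinearMap.ker g)).lTensor C) hw
  rw [hw0, map_zero, map_zero, ← LinearMap.comp_apply, ← LinearMap.lTensor_comp,
    LinearMap.snd_comp_inr, LinearMap.lTensor_id] at h2
  exact h2.symm

/-- Lifting along the cokernel of any embedding of `M` is possible, provided that it is so for
one embedding into an injective module. -/
lemma exists_lift_mkQ_of_injective {I M N : Type u} [AddCommGroup I] [Module R I]
    [AddCommGroup M] [Module R M] [AddCommGroup N] [Module R N] [Module.Injective R I]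
    {f : M →ₗ[R] I} (hf : Function.Injective f)
    (h : ∀ φ : C →ₗ[R] I ⧸ LinearMap.range f, ∃ ψ, (LinearMap.range f).mkQ ∘ₗ ψ = φ)
    (g : M →ₗ[R] N) (hg : Function.Injective g) (φ : C →ₗ[R] N ⧸ LinearMap.range g) :
    ∃ ψ, (LinearMap.range g).mkQ ∘ₗ ψ = φ := by
  obtain ⟨l, hl⟩ := Module.Injective.extension_property R I _ _ g hg f
  have hl' : ∀ x, l (g x) = f x := LinearMap.congr_fun hl
  -- Dually, `0 → N → I × N/M → I/M → 0` is exact. Pairing `φ` with a lift of `lbar ∘ₗ φ` gives a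
  -- map killed by `v`, which therefore factors through `N`.
  let lbar : N ⧸ LinearMap.range g →ₗ[R] I ⧸ LinearMap.range f :=
    (LinearMap.range g).mapQ (LinearMap.range f) l (by
      rintro _ ⟨x, rfl⟩
      exact ⟨x, (hl' x).symm⟩)
  let q : N →ₗ[R] I × (N ⧸ LinearMap.range g) := l.prod (LinearMap.range g).mkQ
  let v : I × (N ⧸ LinearMap.range g) →ₗ[R] I ⧸ LinearMap.range f :=
    (LinearMap.range f).mkQ.coprod (-lbar)
  have hq : Function.Injective q := by
    rw [injective_iff_map_eq_zero]
    intro n hn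
    obtain ⟨x, rfl⟩ := (Submodule.Quotient.mk_eq_zero _).1 (congrArg Prod.snd hn)
    have : f x = 0 := (hl' x).symm.trans (congrArg Prod.fst hn)
    rw [(injective_iff_map_eq_zero f).1 hf x this, map_zero]
  have hex : Function.Exact q v := by
    rintro ⟨x, y⟩
    obtain ⟨n, rfl⟩ := Submodule.mkQ_surjective _ y
    constructor
    · intro hxy
      have hxy' : (LinearMap.range f).mkQ (x - l n) = 0 := by
        rw [map_sub, sub_eq_add_neg]
        exact hxy
      obtain ⟨m, hm⟩ := (Submodule.Quotient.mk_eq_zero _).1 hxy'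
      refine ⟨n + g m, Prod.ext ?_ ?_⟩
      · change l (n + g m) = x
        rw [map_add, hl', hm, add_sub_cancel]
      · change (LinearMap.range g).mkQ (n + g m) = (LinearMap.range g).mkQ n
        rw [map_add, add_eq_left]
        exact (Submodule.Quotient.mk_eq_zero _).2 ⟨m, rfl⟩
    · rintro ⟨n', hn'⟩
      rw [← hn']
      change (LinearMap.range f).mkQ (l n') + -(LinearMap.range f).mkQ (l n') = 0
      rw [add_neg_cancel]
  obtain ⟨ψ, hψ⟩ := h (lbar ∘ₗ φ)
  obtain ⟨χ, hχ⟩ := hex.exists_lift hq (ψ.prod φ) (by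
    rw [LinearMap.coprod_comp_prod, hψ, LinearMap.neg_comp, add_neg_cancel])
  refine ⟨χ, ?_⟩
  have := congrArg (fun t => LinearMap.snd R _ _ ∘ₗ t) hχ
  exact this

/-- The part of membership in the Auslander class of `C` needed for comparing projective
dimensions. -/
structure LinearProjectiveResolution.IsAuslander (F : LinearProjectiveResolution R C)
    (M : Type u) [AddCommGroup M] [Module R M] : Prop where
  unit_bijective : Function.Bijective (tensorUnit (R := R) C M)
  extVanish : F.ExtVanish (C ⊗[R] M)
  injective_lTensor_ker : ∀ (N : Type u) [AddCommGroup N] [Module R N] (g : N →ₗ[R] M),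
    Function.Surjective g → Function.Injective ((LinearMap.ker g).subtype.lTensor C)

/-- The part of membership in the Bass class of `C` needed for comparing injective
dimensions. -/
structure LinearProjectiveResolution.IsBass (F : LinearProjectiveResolution R C)
    (M : Type u) [AddCommGroup M] [Module R M] : Prop where
  counit_bijective : Function.Bijective (homCounit (R := R) C M)
  torVanish : F.TorVanish (C →ₗ[R] M)
  exists_lift_mkQ : ∀ (N : Type u) [AddCommGroup N] [Module R N] (g : M →ₗ[R] N),
    Function.Injective g →
      ∀ φ : C →ₗ[R] N ⧸ LinearMap.range g, ∃ ψ, (LinearMap.range g).mkQ ∘ₗ ψ = φ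

/-- The third field of `IsAuslander` encodes `Tor_1(C, M) = 0`. For a kernel `K` of `P → M` already
in the class, `Hom(C, -)` turns `C ⊗ K → C ⊗ P` into the inclusion `K → P`; conservativity then
makes the former injective, and a five-lemma chase handles the unit of `M`. -/
lemma auslander_of_hasProjectiveDimensionLT (hC : IsSemidualizing R C)
    (F : LinearProjectiveResolution R C) (hfin : ∀ n, Module.Finite R (F.X n))
    (hF : F.ExtVanish C) (k : ℕ) (M : Type u) [AddCommGroup M] [Module R M]
    (hM : HasProjectiveDimensionLT (ModuleCat.of R M) k)  :
    F.IsAuslander M := by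
  refine hasProjectiveDimensionLT_induction (motive := fun M _ _ => F.IsAuslander M) ?_ ?_ k M hM
  · intro P _ _ _
    refine ⟨hC.tensorUnit_bijective_of_projective P, hF.tensor_projective hfin P, ?_⟩
    intro N _ _ g hg
    have hP : F.TorVanish P := fun n => Module.Flat.rTensor_exact P (F.exact_succ n)
    exact hP.injective_lTensor (Submodule.injective_subtype _) g.exact_subtype_ker hg
  · rintro P M _ _ _ _ _ f hf ⟨hη, hext, -⟩
    have hηP := hC.tensorUnit_bijective_of_projective (C := C) P
    have hinj : Function.Injective ((LinearMap.ker f).subtype.lTensor C) := by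
      refine hC.injective_of_comp fun g hg => ?_
      obtain ⟨x, rfl⟩ := hη.2 g
      rw [lTensor_comp_tensorUnit] at hg
      have hx : x = 0 := Subtype.ext ((injective_iff_map_eq_zero _).1 hηP.1 _ hg)
      rw [hx, map_zero]
    have hexact := lTensor_exact C f.exact_subtype_ker hf
    have hsurj := LinearMap.lTensor_surjective C hf
    refine ⟨⟨?_, ?_⟩, hext.of_shortExact (hF.tensor_projective hfin P) hinj hexact hsurj,
      fun N _ _ g hg => injective_lTensor_ker_of_projective hf hinj g hg⟩
    · rw [injective_iff_map_eq_zero]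
      intro m hm
      obtain ⟨p, rfl⟩ := hf m
      obtain ⟨g, hg⟩ := hexact.exists_lift hinj (tensorUnit C P p) (by
        rw [lTensor_comp_tensorUnit, hm])
      obtain ⟨x, rfl⟩ := hη.2 g
      rw [lTensor_comp_tensorUnit] at hg
      rw [← hηP.1 hg]
      exact x.2
    · intro g
      obtain ⟨g', rfl⟩ := hext.exists_lift hinj hexact hsurj g
      obtain ⟨p, rfl⟩ := hηP.2 g'
      exact ⟨f p, (lTensor_comp_tensorUnit f p).symm⟩

lemma LinearProjectiveResolution.extVanish_of_injective (F : LinearProjectiveResolution R C)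
    (I : Type u) [AddCommGroup I] [Module R I] [Module.Injective R I] : F.ExtVanish I :=
  fun n f hf => (F.exact_succ n).exists_desc_of_injective f hf

/-- Dual to the Auslander case; the third field of `IsBass` encodes `Ext^1(C, M) = 0`. -/
lemma bass_of_hasInjectiveDimensionLT (hC : IsSemidualizing R C)
    (F : LinearProjectiveResolution R C) (hfin : ∀ n, Module.Finite R (F.X n))
    (hF : F.ExtVanish C) (k : ℕ) (M : Type u) [AddCommGroup M] [Module R M]
    (hM : HasInjectiveDimensionLT (ModuleCat.of R M) k) :
    F.IsBass M := by
  refine hasInjectiveDimensionLT_induction (motive := fun M _ _ => F.IsBass M) ?_ ?_ k M hM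
  · intro I _ _ _
    refine ⟨hC.homCounit_bijective_of_injective I, hF.torVanish_hom_injective hfin, ?_⟩
    intro N _ _ g hg φ
    exact (F.extVanish_of_injective I).exists_lift hg (LinearMap.exact_map_mkQ_range g)
      (Submodule.mkQ_surjective _) φ
  · rintro M I _ _ _ _ _ f hf ⟨hν, htor, -⟩
    have hνI := hC.homCounit_bijective_of_injective (C := C) I
    let p := (LinearMap.range f).mkQ
    have hfp : Function.Exact f p := LinearMap.exact_map_mkQ_range f
    have hp : Function.Surjective p := Submodule.mkQ_surjective _
    -- After tensoring with `C`, the counits identify this map with the surjection `p`.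
    have hsurj : Function.Surjective (LinearMap.compRight (M := C) R p) := by
      refine hC.surjective_of_lTensor fun z => ?_
      obtain ⟨x, hx⟩ := hp (homCounit C _ z)
      obtain ⟨w, rfl⟩ := hνI.2 x
      exact ⟨w, hν.1 (by rw [homCounit_lTensor, hx])⟩
    have hinj : Function.Injective (LinearMap.compRight (M := C) R f) := fun _ _ h =>
      (LinearMap.cancel_left hf).1 h
    have hexact : Function.Exact (LinearMap.compRight (M := C) R f)
        (LinearMap.compRight (M := C) R p) := by
      intro g
      refine ⟨fun hg => hfp.exists_lift hf g hg, ?_⟩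
      rintro ⟨g, rfl⟩
      ext c
      exact hfp.apply_apply_eq_zero (g c)
    have hinj' := htor.injective_lTensor hinj hexact hsurj
    refine ⟨⟨?_, ?_⟩, (hF.torVanish_hom_injective hfin).of_shortExact htor hinj hexact hsurj,
      fun N _ _ g hg φ => exists_lift_mkQ_of_injective hf hsurj g hg φ⟩
    · rw [injective_iff_map_eq_zero]
      intro z hz
      refine (injective_iff_map_eq_zero _).1 hinj' z ((injective_iff_map_eq_zero _).1 hνI.1 _ ?_)
      rw [homCounit_lTensor, hz, map_zero]
    · intro x
      obtain ⟨w, hw⟩ := hνI.2 (f x)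
      obtain ⟨z, rfl⟩ := (lTensor_exact C hexact hsurj w).1
        ((injective_iff_map_eq_zero _).1 hν.1 _ (by
          rw [homCounit_lTensor, hw, hfp.apply_apply_eq_zero]))
      exact ⟨z, hf (by rw [← hw, homCounit_lTensor])⟩

lemma IsSemidualizing.hasProjectiveDimensionLT_hom_tensor_iff (hC : IsSemidualizing R C)
    (M : Type u) [AddCommGroup M] [Module R M] (k : ℕ) :
    HasProjectiveDimensionLT (ModuleCat.of R M) k ↔
      HasProjectiveDimensionLT (ModuleCat.of R (C →ₗ[R] C ⊗[R] M)) k := by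
  obtain ⟨F, hfin, hF⟩ := hC.exists_resolution
  constructor
  · intro h
    have hη := (auslander_of_hasProjectiveDimensionLT hC F hfin hF k M h).unit_bijective
    exact hasProjectiveDimensionLT_of_linearEquiv (LinearEquiv.ofBijective _ hη) h
  · intro h
    obtain ⟨hη, -, htor⟩ := auslander_of_hasProjectiveDimensionLT hC F hfin hF k _ h
    -- One triangle identity and bijectivity of the unit at `Hom(C, C ⊗ M)` give injectivity after
    -- `Hom(C, -)`. The other identity then makes `C ⊗ -` of the unit of `M` bijective.
    have hν : Function.Injective (homCounit (R := R) C (C ⊗[R] M)) := by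
      refine hC.injective_of_comp fun g hg => ?_
      obtain ⟨x, rfl⟩ := hη.2 g
      rw [homCounit_comp_tensorUnit] at hg
      rw [hg, map_zero]
    have hb : Function.Bijective ((tensorUnit (R := R) C M).lTensor C) := by
      constructor
      · exact Function.LeftInverse.injective homCounit_lTensor_tensorUnit
      · exact fun z => ⟨homCounit C _ z, hν (homCounit_lTensor_tensorUnit _)⟩
    have hsurj : Function.Surjective (tensorUnit (R := R) C M) := hC.surjective_of_lTensor hb.2
    -- `Tor_1(C, Hom(C, C ⊗ M)) = 0` keeps `C ⊗ ker` inside `C ⊗ M`, where it lies in the kernel of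
    -- an injective map.
    have hz : ∀ z : C ⊗[R] LinearMap.ker (tensorUnit (R := R) C M), z = 0 := by
      intro z
      refine (injective_iff_map_eq_zero _).1 (htor M _ hsurj) z
        ((injective_iff_map_eq_zero _).1 hb.1 _ ?_)
      rw [← LinearMap.comp_apply, ← LinearMap.lTensor_comp, LinearMap.comp_ker_subtype,
        LinearMap.lTensor_zero, LinearMap.zero_apply]
    have hinj : Function.Injective (tensorUnit (R := R) C M) := by
      rw [injective_iff_map_eq_zero]
      exact fun x hx => congrArg Subtype.val (hC.eq_zero_of_tensor_eq_zero hz ⟨x, hx⟩)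
    exact hasProjectiveDimensionLT_of_linearEquiv
      (LinearEquiv.ofBijective _ ⟨hinj, hsurj⟩).symm h

lemma IsSemidualizing.hasInjectiveDimensionLT_tensor_hom_iff (hC : IsSemidualizing R C)
    (M : Type u) [AddCommGroup M] [Module R M] (k : ℕ) :
    HasInjectiveDimensionLT (ModuleCat.of R M) k ↔
      HasInjectiveDimensionLT (ModuleCat.of R (C ⊗[R] (C →ₗ[R] M))) k := by
  obtain ⟨F, hfin, hF⟩ := hC.exists_resolution
  constructor
  · intro h
    have hν := (bass_of_hasInjectiveDimensionLT hC F hfin hF k M h).counit_bijective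
    exact hasInjectiveDimensionLT_of_linearEquiv (LinearEquiv.ofBijective _ hν).symm h
  · intro h
    obtain ⟨hν, -, hext⟩ := bass_of_hasInjectiveDimensionLT hC F hfin hF k _ h
    have hη : Function.Surjective (tensorUnit (R := R) C (C →ₗ[R] M)) :=
      hC.surjective_of_lTensor fun z =>
        ⟨homCounit C _ z, hν.1 (homCounit_lTensor_tensorUnit _)⟩
    have hinj : Function.Injective (homCounit (R := R) C M) := by
      refine hC.injective_of_comp fun g hg => ?_
      obtain ⟨x, rfl⟩ := hη g
      rw [homCounit_comp_tensorUnit] at hg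
      rw [hg, map_zero]
    -- Any `φ` lifts to `ψ : C → M`, and by the triangle identity `ψ` factors through the counit, so
    -- it dies in the cokernel.
    have hz : ∀ φ : C →ₗ[R] M ⧸ LinearMap.range (homCounit (R := R) C M), φ = 0 := by
      intro φ
      obtain ⟨ψ, rfl⟩ := hext M _ hinj φ
      rw [← homCounit_comp_tensorUnit ψ, ← LinearMap.comp_assoc, LinearMap.range_mkQ_comp,
        LinearMap.zero_comp]
    have hsurj : Function.Surjective (homCounit (R := R) C M) := fun x =>
      (Submodule.Quotient.mk_eq_zero _).1 (hC.eq_zero_of_hom_eq_zero hz (Submodule.Quotient.mk x))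
    exact hasInjectiveDimensionLT_of_linearEquiv (LinearEquiv.ofBijective _ ⟨hinj, hsurj⟩) h

end FoxbyClasses

/-! ### Dimensions as strict bounds by natural numbers. -/

section Dimensions

/-- Strict bounds are used because they pass through the infimum as plain existence of a resolution;
`k = 0` detects `-∞`. -/
lemma sSup_nontrivial_lt_iff {X : ℕ → Type u} (k : ℕ) :
    sSup {m : WithBot ℕ∞ | ∃ n : ℕ, m = (n : WithBot ℕ∞) ∧ Nontrivial (X n)} < (k : WithBot ℕ∞) ↔
      ∀ n, k ≤ n → Subsingleton (X n) := by
  constructor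
  · intro h n hn
    by_contra hX
    rw [not_subsingleton_iff_nontrivial] at hX
    have hmem : (n : WithBot ℕ∞) ∈
        {m : WithBot ℕ∞ | ∃ n : ℕ, m = (n : WithBot ℕ∞) ∧ Nontrivial (X n)} := ⟨n, rfl, hX⟩
    have h1 : (n : WithBot ℕ∞) < k := lt_of_le_of_lt (le_sSup hmem) h
    exact absurd (Nat.cast_lt.1 h1) (by omega)
  · intro h
    have hlt : ∀ n, Nontrivial (X n) → n < k := by
      intro n hX
      by_contra hn
      exact not_subsingleton_iff_nontrivial.2 hX (h n (by omega))
    obtain _ | k := k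
    · refine lt_of_le_of_lt (b := ⊥) (sSup_le ?_) (by decide)
      rintro _ ⟨n, -, hX⟩
      exact absurd (hlt n hX) (by omega)
    · refine lt_of_le_of_lt (b := (k : WithBot ℕ∞)) (sSup_le ?_) (Nat.cast_lt.2 k.lt_succ_self)
      rintro _ ⟨n, rfl, hX⟩
      exact Nat.cast_le.2 (Nat.lt_succ_iff.1 (hlt n hX))

lemma WithBot.le_of_forall_lt_natCast {a b : WithBot ℕ∞}
    (h : ∀ k : ℕ, b < k → a < k) : a ≤ b := by
  induction b with
  | bot =>
    have := h 0 (by decide)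
    rw [Nat.cast_zero, WithBot.lt_zero_iff_eq_bot] at this
    exact this.le
  | coe b =>
    induction b with
    | top => exact le_top
    | coe b => exact ENat.WithBot.lt_add_one_iff.1 (h (b + 1) (Nat.cast_lt.2 b.lt_succ_self))

lemma WithBot.eq_of_forall_lt_natCast_iff {a b : WithBot ℕ∞}
    (h : ∀ k : ℕ, a < k ↔ b < k) : a = b :=
  le_antisymm (WithBot.le_of_forall_lt_natCast fun k => (h k).2)
    (WithBot.le_of_forall_lt_natCast fun k => (h k).1)

variable {R : Type u} [CommRing R] {C : Type u} [AddCommGroup C] [Module R C]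
  {M : Type u} [AddCommGroup M] [Module R M]

lemma pcProjectiveDimension_lt_iff (k : ℕ) :
    pcProjectiveDimension R C M < k ↔
      ∃ X : ProperPCResolution R C M, ∀ n, k ≤ n → Subsingleton (X.X n) := by
  simp only [pcProjectiveDimension, iInf_lt_iff, sSup_nontrivial_lt_iff]

lemma icInjectiveDimension_lt_iff (k : ℕ) :
    icInjectiveDimension R C M < k ↔
      ∃ Y : ProperICResolution R C M, ∀ n, k ≤ n → Subsingleton (Y.Y n) := by
  simp only [icInjectiveDimension, iInf_lt_iff, sSup_nontrivial_lt_iff]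

end Dimensions

attribute [instance] ProperPCResolution.addCommGroup ProperPCResolution.module
  ProperICResolution.addCommGroup ProperICResolution.module

/-! ### Proper `P_C`-resolutions of `M` versus projective resolutions of `Hom(C, M)`. -/

section ProperProjective

variable {R : Type u} [CommRing R] {C : Type u} [AddCommGroup C] [Module R C]

/-- Maps out of `C ⊗ Q`, for projective `Q`, see the exactness of `Hom(C, -)`. -/
lemma exact_comp_tensor_projective {A B D Q : Type u} [AddCommGroup A] [Module R A]
    [AddCommGroup B] [Module R B] [AddCommGroup D] [Module R D] [AddCommGroup Q] [Module R Q]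
    [Module.Projective R Q] {u : A →ₗ[R] B} {v : B →ₗ[R] D} (hvu : v ∘ₗ u = 0)
    (h : ∀ g : C →ₗ[R] B, v ∘ₗ g = 0 → ∃ g', u ∘ₗ g' = g) :
    Function.Exact (fun f : C ⊗[R] Q →ₗ[R] A => u ∘ₗ f) (fun f : C ⊗[R] Q →ₗ[R] B => v ∘ₗ f) := by
  intro f
  constructor
  · intro hf
    have hex : Function.Exact (LinearMap.compRight (M := C) R u)
        (LinearMap.compRight (M := C) R v) := by
      intro g
      refine ⟨h g, ?_⟩
      rintro ⟨g, rfl⟩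
      ext c
      exact LinearMap.congr_fun hvu (g c)
    obtain ⟨ψ, hψ⟩ := hex.exists_lift_of_projective (TensorProduct.curry f).flip (by
      ext q c
      exact LinearMap.congr_fun hf (c ⊗ₜ q))
    refine ⟨TensorProduct.lift ψ.flip, ?_⟩
    ext c q
    exact LinearMap.congr_fun (LinearMap.congr_fun hψ q) c
  · rintro ⟨g, rfl⟩
    ext c q
    exact LinearMap.congr_fun hvu _

/-- The test module `Q = R` suffices, as `C ⊗ R ≅ C`. -/
lemma exact_comp_of_exact_comp_tensor {A B D : Type u} [AddCommGroup A] [Module R A]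
    [AddCommGroup B] [Module R B] [AddCommGroup D] [Module R D]
    {u : A →ₗ[R] B} {v : B →ₗ[R] D}
    (h : Function.Exact (fun f : C ⊗[R] R →ₗ[R] A => u ∘ₗ f)
      (fun f : C ⊗[R] R →ₗ[R] B => v ∘ₗ f)) :
    Function.Exact (LinearMap.compRight (M := C) R u) (LinearMap.compRight (M := C) R v) := by
  let e := TensorProduct.rid R C
  intro g
  constructor
  · intro hg
    obtain ⟨f, hf⟩ := (h (g ∘ₗ e.toLinearMap)).1 (by
      ext c
      simpa [e] using LinearMap.congr_fun hg c)
    refine ⟨f ∘ₗ e.symm.toLinearMap, ?_⟩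
    ext c
    simpa [e] using LinearMap.congr_fun hf (c ⊗ₜ 1)
  · rintro ⟨f, rfl⟩
    have := (h (u ∘ₗ f ∘ₗ e.toLinearMap)).2 ⟨f ∘ₗ e.toLinearMap, rfl⟩
    ext c
    simpa [e] using LinearMap.congr_fun this (c ⊗ₜ 1)

/-- Applying `Hom(C, -)` to a proper resolution of `M` gives a projective resolution of
`Hom(C, M)`. -/
noncomputable def ProperPCResolution.hom (hC : IsSemidualizing R C) {M : Type u} [AddCommGroup M]
    [Module R M] (X : ProperPCResolution R C M) : LinearProjectiveResolution R (C →ₗ[R] M) where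
  X n := ModuleCat.of R (C →ₗ[R] X.X n)
  d n := LinearMap.compRight R (X.d n)
  ε := LinearMap.compRight R X.ε
  projective n := by
    obtain ⟨P, _, _, _, ⟨e⟩⟩ := X.isCProjective n
    exact Module.Projective.of_equiv
      ((LinearEquiv.ofBijective _ (hC.tensorUnit_bijective_of_projective P)).trans
        (LinearEquiv.congrRight e.symm))
  surjective g := by
    obtain ⟨f, hf⟩ := X.proper_augmentation R (g ∘ₗ (TensorProduct.rid R C).toLinearMap)
    refine ⟨f ∘ₗ (TensorProduct.rid R C).symm.toLinearMap, ?_⟩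
    ext c
    simpa using LinearMap.congr_fun hf (c ⊗ₜ 1)
  exact_zero := exact_comp_of_exact_comp_tensor (X.proper_zero R)
  exact_succ n := exact_comp_of_exact_comp_tensor (X.proper_succ R n)

/-- Tensoring a projective resolution of `Hom(C, M)` with `C` gives a proper resolution
of `M`. -/
noncomputable def LinearProjectiveResolution.toProper (hC : IsSemidualizing R C) {M : Type u}
    [AddCommGroup M] [Module R M] (F : LinearProjectiveResolution R (C →ₗ[R] M)) :
    ProperPCResolution R C M where
  X n := C ⊗[R] F.X n
  d n := (F.d n).lTensor C
  ε := homCounit C M ∘ₗ F.ε.lTensor C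
  d_comp_d n := by rw [← LinearMap.lTensor_comp, F.d_comp_d, LinearMap.lTensor_zero]
  ε_comp_d := by
    rw [LinearMap.comp_assoc, ← LinearMap.lTensor_comp, F.ε_comp_d, LinearMap.lTensor_zero,
      LinearMap.comp_zero]
  isCProjective n := ⟨F.X n, inferInstance, inferInstance, F.projective n, ⟨.refl R _⟩⟩
  proper_augmentation Q _ _ _ f := by
    obtain ⟨ψ, hψ⟩ := Module.projective_lifting_property F.ε (TensorProduct.curry f).flip
      F.surjective
    refine ⟨ψ.lTensor C, ?_⟩
    ext c q
    simpa using LinearMap.congr_fun (LinearMap.congr_fun hψ q) c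
  proper_zero Q _ _ _ := by
    refine exact_comp_tensor_projective ?_ fun g hg => ?_
    · rw [LinearMap.comp_assoc, ← LinearMap.lTensor_comp, F.ε_comp_d, LinearMap.lTensor_zero,
        LinearMap.comp_zero]
    · obtain ⟨x, rfl⟩ := (hC.tensorUnit_bijective_of_projective (F.X 0)).2 g
      -- Under the unit, the augmentation becomes `F.ε`, by the triangle identity.
      rw [LinearMap.comp_assoc, lTensor_comp_tensorUnit, homCounit_comp_tensorUnit] at hg
      obtain ⟨y, rfl⟩ := (F.exact_zero x).1 hg
      exact ⟨_, lTensor_comp_tensorUnit _ y⟩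
  proper_succ Q _ _ _ n := by
    refine exact_comp_tensor_projective ?_ fun g hg => ?_
    · rw [← LinearMap.lTensor_comp, F.d_comp_d, LinearMap.lTensor_zero]
    · obtain ⟨x, rfl⟩ := (hC.tensorUnit_bijective_of_projective (F.X (n + 1))).2 g
      rw [lTensor_comp_tensorUnit] at hg
      obtain ⟨y, rfl⟩ := (F.exact_succ n x).1 ((injective_iff_map_eq_zero _).1
        (hC.tensorUnit_bijective_of_projective (F.X n)).1 _ hg)
      exact ⟨_, lTensor_comp_tensorUnit _ y⟩

theorem IsSemidualizing.pcProjectiveDimension_eq (hC : IsSemidualizing R C) (M : Type u)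
    [AddCommGroup M] [Module R M] :
    pcProjectiveDimension R C M = projectiveDimension (ModuleCat.of R (C →ₗ[R] M)) := by
  refine WithBot.eq_of_forall_lt_natCast_iff fun k => ?_
  rw [pcProjectiveDimension_lt_iff, projectiveDimension_lt_iff,
    hasProjectiveDimensionLT_iff_exists_resolution]
  constructor
  · rintro ⟨X, hX⟩
    refine ⟨X.hom hC, fun n hn => ?_⟩
    have := hX n hn
    exact inferInstanceAs (Subsingleton (C →ₗ[R] X.X n))
  · rintro ⟨F, hF⟩
    refine ⟨F.toProper hC, fun n hn => ?_⟩
    have := hF n hn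
    exact inferInstanceAs (Subsingleton (C ⊗[R] F.X n))

end ProperProjective

/-! ### Proper `I_C`-resolutions of `M` versus injective resolutions of `C ⊗ M`. -/

section ProperInjective

variable {R : Type u} [CommRing R] {C : Type u} [AddCommGroup C] [Module R C]

/-- By adjunction these are maps from `C ⊗ -` to `J`, and `Hom(-, J)` is exact. -/
lemma exact_precomp_hom_injective {A B D J : Type u} [AddCommGroup A] [Module R A]
    [AddCommGroup B] [Module R B] [AddCommGroup D] [Module R D] [AddCommGroup J] [Module R J]
    [Module.Injective R J] {u : A →ₗ[R] B} {v : B →ₗ[R] D}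
    (h : Function.Exact (u.lTensor C) (v.lTensor C)) (hvu : v ∘ₗ u = 0) :
    Function.Exact (fun f : D →ₗ[R] C →ₗ[R] J => f ∘ₗ v)
      (fun f : B →ₗ[R] C →ₗ[R] J => f ∘ₗ u) := by
  intro f
  constructor
  · intro hf
    obtain ⟨ψ, hψ⟩ := h.exists_desc_of_injective (TensorProduct.lift f.flip) (by
      ext c a
      exact LinearMap.congr_fun (LinearMap.congr_fun hf a) c)
    refine ⟨(TensorProduct.curry ψ).flip, ?_⟩
    ext b c
    exact LinearMap.congr_fun hψ (c ⊗ₜ b)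
  · rintro ⟨g, rfl⟩
    change (g ∘ₗ v) ∘ₗ u = 0
    rw [LinearMap.comp_assoc, hvu, LinearMap.comp_zero]

/-- Maps to injectives detect exactness: test against an embedding of the cokernel of `C ⊗ u` into
an injective. -/
lemma exact_lTensor_of_exact_precomp {A B D : Type u} [AddCommGroup A] [Module R A]
    [AddCommGroup B] [Module R B] [AddCommGroup D] [Module R D]
    {u : A →ₗ[R] B} {v : B →ₗ[R] D} (hvu : v ∘ₗ u = 0)
    (h : ∀ (J : Type u) [AddCommGroup J] [Module R J] [Module.Injective R J],
      Function.Exact (fun f : D →ₗ[R] C →ₗ[R] J => f ∘ₗ v)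
        (fun f : B →ₗ[R] C →ₗ[R] J => f ∘ₗ u)) :
    Function.Exact (u.lTensor C) (v.lTensor C) := by
  intro z
  constructor
  · intro hz
    obtain ⟨J, _, _, _, i, hi⟩ := exists_injective_embedding R
      (C ⊗[R] B ⧸ LinearMap.range (u.lTensor C))
    let φ : C ⊗[R] B →ₗ[R] J := i ∘ₗ (LinearMap.range (u.lTensor C)).mkQ
    have hφ : φ ∘ₗ u.lTensor C = 0 := by
      rw [LinearMap.comp_assoc, LinearMap.range_mkQ_comp, LinearMap.comp_zero]
    obtain ⟨g, hg⟩ := (h J (TensorProduct.curry φ).flip).1 (by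
      ext a c
      exact LinearMap.congr_fun hφ (c ⊗ₜ a))
    have hg' : TensorProduct.lift g.flip ∘ₗ v.lTensor C = φ := by
      ext c b
      exact LinearMap.congr_fun (LinearMap.congr_fun hg b) c
    have hz' : φ z = 0 := by rw [← hg', LinearMap.comp_apply, hz, map_zero]
    exact (Submodule.Quotient.mk_eq_zero _).1 ((injective_iff_map_eq_zero i).1 hi _ hz')
  · rintro ⟨w, rfl⟩
    rw [← LinearMap.comp_apply, ← LinearMap.lTensor_comp, hvu]
    simp

/-- Tensoring a proper resolution of `M` with `C` gives an injective resolution of `C ⊗ M`. -/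
noncomputable def ProperICResolution.tensor (hC : IsSemidualizing R C) {M : Type u}
    [AddCommGroup M] [Module R M] (Y : ProperICResolution R C M) :
    LinearInjectiveResolution R (C ⊗[R] M) where
  X n := ModuleCat.of R (C ⊗[R] Y.Y n)
  d n := (Y.d n).lTensor C
  η := Y.η.lTensor C
  injective n := by
    obtain ⟨I, _, _, _, ⟨e⟩⟩ := Y.isCInjective n
    exact Module.Injective.of_linearEquiv
      ((LinearEquiv.ofBijective _ (hC.homCounit_bijective_of_injective I)).symm.trans
        (LinearEquiv.lTensor C e.symm))
  η_injective := by
    obtain ⟨J, _, _, _, i, hi⟩ := exists_injective_embedding R (C ⊗[R] M)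
    obtain ⟨g, hg⟩ := Y.proper_augmentation J (TensorProduct.curry i).flip
    have hg' : TensorProduct.lift g.flip ∘ₗ Y.η.lTensor C = i := by
      ext c b
      exact LinearMap.congr_fun (LinearMap.congr_fun hg b) c
    rw [← hg', LinearMap.coe_comp] at hi
    exact hi.of_comp
  exact_zero := exact_lTensor_of_exact_precomp Y.d_comp_η Y.proper_zero
  exact_succ n := exact_lTensor_of_exact_precomp (Y.d_comp_d n) fun J => Y.proper_succ J n

/-- Applying `Hom(C, -)` to an injective resolution of `C ⊗ M` gives a proper resolution
of `M`. -/
noncomputable def LinearInjectiveResolution.toProper (hC : IsSemidualizing R C) {M : Type u}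
    [AddCommGroup M] [Module R M] (F : LinearInjectiveResolution R (C ⊗[R] M)) :
    ProperICResolution R C M := by
  have hν := fun n => hC.homCounit_bijective_of_injective (F.X n)
  -- The counit identifies `C ⊗ Hom(C, F.X 0)` with `F.X 0`, and the tensored augmentation with
  -- `F.η`.
  have hη : ∀ z, homCounit C _ ((LinearMap.compRight R F.η ∘ₗ tensorUnit C M).lTensor C z) =
      F.η z := by
    intro z
    rw [LinearMap.lTensor_comp, LinearMap.comp_apply, homCounit_lTensor,
      homCounit_lTensor_tensorUnit]
  have hdη : LinearMap.compRight R (F.d 0) ∘ₗ LinearMap.compRight R F.η ∘ₗ tensorUnit C M = 0 := by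
    ext m c
    exact F.exact_zero.apply_apply_eq_zero _
  have hdd : ∀ n, LinearMap.compRight (M := C) R (F.d (n + 1)) ∘ₗ
      LinearMap.compRight (M := C) R (F.d n) = 0 := by
    intro n
    ext g c
    exact (F.exact_succ n).apply_apply_eq_zero _
  exact
  { Y n := C →ₗ[R] F.X n
    d n := LinearMap.compRight R (F.d n)
    η := LinearMap.compRight R F.η ∘ₗ tensorUnit C M
    d_comp_d := hdd
    d_comp_η := hdη
    isCInjective n := ⟨F.X n, inferInstance, inferInstance, F.injective n, ⟨.refl R _⟩⟩
    proper_augmentation J _ _ _ f := by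
      have hinj : Function.Injective
          ((LinearMap.compRight R F.η ∘ₗ tensorUnit C M).lTensor C) := by
        intro z w hzw
        exact F.η_injective (by rw [← hη, hzw, hη])
      obtain ⟨ψ, hψ⟩ := Module.Injective.extension_property R J _ _ _ hinj
        (TensorProduct.lift f.flip)
      refine ⟨(TensorProduct.curry ψ).flip, ?_⟩
      ext m c
      exact LinearMap.congr_fun hψ (c ⊗ₜ m)
    proper_zero J _ _ _ := by
      refine exact_precomp_hom_injective (fun z => ?_) hdη
      rw [← (injective_iff_map_eq_zero' _).1 (hν 1).1, homCounit_lTensor, F.exact_zero]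
      constructor
      · rintro ⟨w, hw⟩
        exact ⟨w, (hν 0).1 (by rw [hη, hw])⟩
      · rintro ⟨w, rfl⟩
        exact ⟨w, (hη w).symm⟩
    proper_succ J _ _ _ n := by
      refine exact_precomp_hom_injective (fun z => ?_) (hdd n)
      rw [← (injective_iff_map_eq_zero' _).1 (hν (n + 2)).1, homCounit_lTensor, F.exact_succ]
      constructor
      · rintro ⟨x, hx⟩
        obtain ⟨w, rfl⟩ := (hν n).2 x
        exact ⟨w, (hν (n + 1)).1 (by rw [homCounit_lTensor, hx])⟩
      · rintro ⟨w, rfl⟩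
        exact ⟨_, (homCounit_lTensor _ _).symm⟩ }

theorem IsSemidualizing.icInjectiveDimension_eq (hC : IsSemidualizing R C) (M : Type u)
    [AddCommGroup M] [Module R M] :
    icInjectiveDimension R C M = injectiveDimension (ModuleCat.of R (C ⊗[R] M)) := by
  refine WithBot.eq_of_forall_lt_natCast_iff fun k => ?_
  rw [icInjectiveDimension_lt_iff, injectiveDimension_lt_iff,
    hasInjectiveDimensionLT_iff_exists_resolution]
  constructor
  · rintro ⟨Y, hY⟩
    refine ⟨Y.tensor hC, fun n hn => ?_⟩
    have := hY n hn
    exact inferInstanceAs (Subsingleton (C ⊗[R] Y.Y n))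
  · rintro ⟨F, hF⟩
    refine ⟨F.toProper hC, fun n hn => ?_⟩
    have := hF n hn
    exact inferInstanceAs (Subsingleton (C →ₗ[R] F.X n))

end ProperInjective

/-! ### The four equalities. -/

theorem mainTheorem2 {R : Type u} [CommRing R]
    {C : Type u} [AddCommGroup C] [Module R C] (hC : IsSemidualizing R C)
    (M : Type u) [AddCommGroup M] [Module R M] :
    projectiveDimension (ModuleCat.of R M) = pcProjectiveDimension R C (C ⊗[R] M) ∧
    icInjectiveDimension R C M = injectiveDimension (ModuleCat.of R (C ⊗[R] M)) ∧
    pcProjectiveDimension R C M = projectiveDimension (ModuleCat.of R (C →ₗ[R] M)) ∧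
    injectiveDimension (ModuleCat.of R M) = icInjectiveDimension R C (C →ₗ[R] M) := by
  refine ⟨?_, hC.icInjectiveDimension_eq M, hC.pcProjectiveDimension_eq M, ?_⟩
  · rw [hC.pcProjectiveDimension_eq]
    refine WithBot.eq_of_forall_lt_natCast_iff fun k => ?_
    rw [projectiveDimension_lt_iff, projectiveDimension_lt_iff,
      hC.hasProjectiveDimensionLT_hom_tensor_iff]
  · rw [hC.icInjectiveDimension_eq]
    refine WithBot.eq_of_forall_lt_natCast_iff fun k => ?_
    rw [injectiveDimension_lt_iff, injectiveDimension_lt_iff,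
      hC.hasInjectiveDimensionLT_tensor_hom_iff]
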